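/- Let $\Bbbk$ be a field. A *cocommutative Hopf brace* over $\Bbbk$ is a datum $(A,\cdot,\bullet,1,\Delta,\varepsilon,S,T)$ such that $(A,\cdot,1,\Delta,\varepsilon,S)$ and $(A,\bullet,1,\Delta,\varepsilon,T)$ are Hopf algebras over $\Bbbk$ with the same cocommutative coalgebra structure and the same unit, and $$a\bullet(b\cdot c)=(a_1\bullet b)\cdot S(a_2)\cdot(a_3\bullet c)\qquad\text{for all } a,b,c\in A$$ (Sweedler notation). Morphisms are the linear maps that preserve $\cdot$, $\bullet$, $1$, $\Delta$ and $\varepsilon$; this gives a category $\mathsf{HBR}_{\mathrm{coc}}$, whose zero morphisms are the maps $a\mapsto\varepsilon(a)1$. A *sub-Hopf brace* of $A$ is a vector subspace $B\subseteq A$ that contains $1$, is closed under $\cdot$, $\bullet$, $S$ and $T$, and satisfies $\Delta(B)\subseteq B\otimes B$; with the restricted operations it is itself a cocommutative Hopf brace. Put $B^+=\{b\in B\mid\varepsilon(b)=0\}$, and let $A\cdot B^+$ and $A\bullet B^+$ be the linear spans of the elements $a\cdot b$ and $a\bullet b$, respectively, with $a\in A$, $b\in B^+$. Write $a\rightharpoonup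 b=S(a_1)\cdot(a_2\bullet b)$. A *Hopf brace ideal* of $A$ is a vector subspace $I\subseteq A$ with $A\cdot I,\ I\cdot A,\ A\bullet I,\ I\bullet A\subseteq I$, $\Delta(I)\subseteq I\otimes A+A\otimes I$, $\varepsilon(I)=0$, $S(I)\subseteq I$ and $T(I)\subseteq I$. **Proposition 3.4.** Let $A$ be a cocommutative Hopf brace over $\Bbbk$ and let $B$ be a sub-Hopf brace of $A$. The following are equivalent: 1. $B$ is normal, that is, for all $a\in A$ and $b\in B$, $$a_1\cdot b\cdot S(a_2)\in B,\qquad a_1\bullet b\bullet T(a_2)\in B,\qquad a\rightharpoonup b\in B.$$ 2. $A\cdot B^+=A\bullet B^+$, and this subspace is a Hopf brace ideal of $A$. 3. $B$ is a kernel in $\mathsf{HBR}_{\mathrm{coc}}$: there are an object $C$ and a morphism $f:A\to C$ of $\mathsf{HBR}_{\mathrm{coc}}$ such that the inclusion $B\hookrightarrow A$ is a kernel of $f$ in $\mathsf{HBR}_{\mathrm{coc}}$. -/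

import Mathlib

open CategoryTheory CategoryTheory.Limits TensorProduct

universe u v

noncomputable section

/-- A *Hopf brace* over the field `k`. The Hopf algebra `H^·` is the underlying
`HopfAlgebra k H` (product `*`, antipode `S = antipode k`). The second Hopf algebra `H^•` has the
same unit and the same coalgebra structure, product `circ a b = a • b` and antipode
`circAntipode = T`. -/
class HopfBrace (k : Type u) (H : Type v) [Field k] [Ring H] extends HopfAlgebra k H where
  /-- The second product `a • b`, a bilinear map. -/
  circ : H →ₗ[k] H →ₗ[k] H
  /-- The antipode `T` of the second Hopf algebra structure. -/
  circAntipode : H →ₗ[k] H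
  circ_assoc : ∀ a b c : H, circ (circ a b) c = circ a (circ b c)
  one_circ : ∀ a : H, circ 1 a = a
  circ_one : ∀ a : H, circ a 1 = a
  /-- `ε(a • b) = ε(a) ε(b)`. -/
  counit_circ : ∀ a b : H, counit (circ a b) = counit a * counit b
  /-- `Δ(a • b) = (a₁ • b₁) ⊗ (a₂ • b₂)`. -/
  comul_circ : ∀ a b : H,
    comul (circ a b) = TensorProduct.map₂ circ circ (comul a) (comul b)
  /-- `T(a₁) • a₂ = ε(a) 1`. -/
  circAntipode_circ : ∀ a : H,
    TensorProduct.lift circ (circAntipode.rTensor H (comul a)) = counit a • (1 : H)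
  /-- `a₁ • T(a₂) = ε(a) 1`. -/
  circ_circAntipode : ∀ a : H,
    TensorProduct.lift circ (circAntipode.lTensor H (comul a)) = counit a • (1 : H)
  /-- The compatibility `a • (b · c) = (a₁ • b) · S(a₂) · (a₃ • c)`; the map applied to
  `a₁ ⊗ (a₂ ⊗ a₃)` is `x ⊗ (y ⊗ z) ↦ (x • b) · (S(y) · (z • c))`. -/
  circ_mul : ∀ a b c : H,
    circ a (b * c) =
      LinearMap.mul' k H
        (TensorProduct.map (circ.flip b)
          (LinearMap.mul' k H ∘ₗ TensorProduct.map antipode (circ.flip c))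
          (comul.lTensor H (comul a)))

namespace HopfBrace

/-- The action `a ⇀ b = S(a₁) · (a₂ • b)`. -/
def leftAction (k : Type u) {A : Type v} [Field k] [Ring A] [HopfBrace k A] (a b : A) : A :=
  LinearMap.mul' k A
    (TensorProduct.map (HopfAlgebra.antipode k) ((circ (k := k)).flip b)
      (Coalgebra.comul (R := k) a))

/-- The left adjoint action `a₁ · b · S(a₂)` of the first Hopf algebra structure. -/
def adjoint (k : Type u) {A : Type v} [Field k] [Ring A] [HopfBrace k A] (a b : A) : A :=
  LinearMap.mul' k A
    (TensorProduct.map (LinearMap.mulRight k b) (HopfAlgebra.antipode k)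
      (Coalgebra.comul (R := k) a))

/-- The left adjoint action `a₁ • b • T(a₂)` of the second Hopf algebra structure. -/
def circAdjoint (k : Type u) {A : Type v} [Field k] [Ring A] [HopfBrace k A] (a b : A) : A :=
  TensorProduct.lift (circ (k := k))
    (TensorProduct.map ((circ (k := k)).flip b) (circAntipode (k := k))
      (Coalgebra.comul (R := k) a))

/-- A *Hopf brace ideal*: a subspace `I` that is a two-sided ideal for both products, a coideal
(`Δ(I) ⊆ I ⊗ H + H ⊗ I` and `ε(I) = 0`, see `Submodule.isCoideal_iff_comul_mem`) and stable under
both antipodes. -/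
structure IsIdeal {k : Type u} {H : Type v} [Field k] [Ring H] [HopfBrace k H]
    (I : Submodule k H) : Prop where
  mul_mem_left : ∀ a x : H, x ∈ I → a * x ∈ I
  mul_mem_right : ∀ a x : H, x ∈ I → x * a ∈ I
  circ_mem_left : ∀ a x : H, x ∈ I → circ (k := k) a x ∈ I
  circ_mem_right : ∀ a x : H, x ∈ I → circ (k := k) x a ∈ I
  isCoideal : I.IsCoideal
  antipode_mem : ∀ x : H, x ∈ I → HopfAlgebra.antipode k x ∈ I
  circAntipode_mem : ∀ x : H, x ∈ I → circAntipode (k := k) x ∈ I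

/-- A morphism of Hopf braces: a linear map compatible with `·`, `1`, `Δ`, `ε` (i.e. a bialgebra
homomorphism for the first structure) and with `•`. -/
structure Hom (k : Type u) (A : Type v) (B : Type v) [Field k] [Ring A] [Ring B]
    [HopfBrace k A] [HopfBrace k B] extends A →ₐc[k] B where
  map_circ : ∀ a b : A,
    toBialgHom (circ (k := k) a b) = circ (k := k) (toBialgHom a) (toBialgHom b)

theorem Hom.ext {k : Type u} {A B : Type v} [Field k] [Ring A] [Ring B]
    [HopfBrace k A] [HopfBrace k B] {f g : Hom k A B}
    (h : f.toBialgHom = g.toBialgHom) : f = g := by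
  cases f; cases g; cases h; rfl

/-- The identity morphism. -/
def Hom.id (k : Type u) (A : Type v) [Field k] [Ring A] [HopfBrace k A] : Hom k A A where
  toBialgHom := BialgHom.id k A
  map_circ := fun _ _ => rfl

/-- The composite `g ∘ f`. -/
def Hom.comp {k : Type u} {A B C : Type v} [Field k] [Ring A] [Ring B] [Ring C]
    [HopfBrace k A] [HopfBrace k B] [HopfBrace k C] (g : Hom k B C) (f : Hom k A B) :
    Hom k A C where
  toBialgHom := g.toBialgHom.comp f.toBialgHom
  map_circ := fun a b => by
    simp only [BialgHom.comp_apply, f.map_circ, g.map_circ]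

/-- The zero morphism `u ∘ ε`, i.e. `a ↦ ε(a) 1`. -/
def Hom.zero (k : Type u) (A B : Type v) [Field k] [Ring A] [Ring B]
    [HopfBrace k A] [HopfBrace k B] : Hom k A B where
  toBialgHom := (Bialgebra.unitBialgHom k B).comp (Bialgebra.counitBialgHom k A)
  map_circ := fun a b => by
    change algebraMap k B (Coalgebra.counit (circ (k := k) a b)) =
      circ (k := k) (algebraMap k B (Coalgebra.counit a)) (algebraMap k B (Coalgebra.counit b))
    simp only [counit_circ, Algebra.algebraMap_eq_smul_one, map_smul, LinearMap.smul_apply,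
      one_circ, mul_smul]
    rw [smul_comm]

end HopfBrace

/-- A *sub-Hopf brace* of `A`: a vector subspace containing `1`, closed under `·` (these make it a
subalgebra), `•`, `S`, `T`, and with `Δ(B) ⊆ B ⊗ B` (the image of `B ⊗ B` in `A ⊗ A`). -/
structure SubHopfBrace (k : Type u) (A : Type v) [Field k] [Ring A] [HopfBrace k A]
    extends Subalgebra k A where
  circ_mem : ∀ {a b : A}, a ∈ carrier → b ∈ carrier → HopfBrace.circ (k := k) a b ∈ carrier
  comul_mem : ∀ {a : A}, a ∈ carrier →
    Coalgebra.comul (R := k) a ∈ LinearMap.range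
      (TensorProduct.map toSubalgebra.val.toLinearMap toSubalgebra.val.toLinearMap)
  antipode_mem : ∀ {a : A}, a ∈ carrier → HopfAlgebra.antipode k a ∈ carrier
  circAntipode_mem : ∀ {a : A}, a ∈ carrier → HopfBrace.circAntipode (k := k) a ∈ carrier

namespace SubHopfBrace

/-- The underlying vector space of a sub-Hopf brace, as a type. -/
abbrev Carrier {k : Type u} {A : Type v} [Field k] [Ring A] [HopfBrace k A]
    (B : SubHopfBrace k A) : Type v := B.toSubalgebra

/-- The inclusion as a linear map. -/
abbrev inclₗ {k : Type u} {A : Type v} [Field k] [Ring A] [HopfBrace k A]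
    (B : SubHopfBrace k A) : B.Carrier →ₗ[k] A := B.toSubalgebra.val.toLinearMap

theorem inclₗ_injective {k : Type u} {A : Type v} [Field k] [Ring A] [HopfBrace k A]
    (B : SubHopfBrace k A) : Function.Injective B.inclₗ := Subtype.val_injective

theorem map_inclₗ_injective {k : Type u} {A : Type v} [Field k] [Ring A] [HopfBrace k A]
    (B : SubHopfBrace k A) : Function.Injective (TensorProduct.map B.inclₗ B.inclₗ) :=
  TensorProduct.map_injective_of_flat_flat _ _ B.inclₗ_injective B.inclₗ_injective

/-- The restricted comultiplication `B → B ⊗ B`. -/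
def comulRestrict {k : Type u} {A : Type v} [Field k] [Ring A] [HopfBrace k A]
    (B : SubHopfBrace k A) : B.Carrier →ₗ[k] B.Carrier ⊗[k] B.Carrier :=
  (LinearEquiv.ofInjective (TensorProduct.map B.inclₗ B.inclₗ)
      B.map_inclₗ_injective).symm.toLinearMap ∘ₗ
    (Coalgebra.comul ∘ₗ B.inclₗ).codRestrict
      (LinearMap.range (TensorProduct.map B.inclₗ B.inclₗ)) (fun b => B.comul_mem b.2)

theorem map_comulRestrict {k : Type u} {A : Type v} [Field k] [Ring A] [HopfBrace k A]
    (B : SubHopfBrace k A) (b : B.Carrier) :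
    TensorProduct.map B.inclₗ B.inclₗ (B.comulRestrict b) =
      Coalgebra.comul (R := k) (B.inclₗ b) := by
  have h := LinearEquiv.apply_symm_apply
    (LinearEquiv.ofInjective (TensorProduct.map B.inclₗ B.inclₗ) B.map_inclₗ_injective)
    ((Coalgebra.comul ∘ₗ B.inclₗ).codRestrict
      (LinearMap.range (TensorProduct.map B.inclₗ B.inclₗ)) (fun b => B.comul_mem b.2) b)
  exact congrArg Subtype.val h

theorem map_comp_comulRestrict {k : Type u} {A : Type v} [Field k] [Ring A] [HopfBrace k A]
    (B : SubHopfBrace k A) :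
    TensorProduct.map B.inclₗ B.inclₗ ∘ₗ B.comulRestrict = Coalgebra.comul ∘ₗ B.inclₗ :=
  LinearMap.ext B.map_comulRestrict

instance instCoalgebra {k : Type u} {A : Type v} [Field k] [Ring A] [HopfBrace k A]
    (B : SubHopfBrace k A) : Coalgebra k B.Carrier where
  comul := B.comulRestrict
  counit := Coalgebra.counit ∘ₗ B.inclₗ
  coassoc := by
    have hinj : Function.Injective
        (TensorProduct.map B.inclₗ (TensorProduct.map B.inclₗ B.inclₗ)) :=
      TensorProduct.map_injective_of_flat_flat _ _ B.inclₗ_injective B.map_inclₗ_injective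
    refine LinearMap.cancel_left hinj |>.1 ?_
    have e1 : TensorProduct.map B.inclₗ (TensorProduct.map B.inclₗ B.inclₗ) ∘ₗ
        (TensorProduct.assoc k B.Carrier B.Carrier B.Carrier).toLinearMap =
        (TensorProduct.assoc k A A A).toLinearMap ∘ₗ
          TensorProduct.map (TensorProduct.map B.inclₗ B.inclₗ) B.inclₗ := by
      apply TensorProduct.ext_threefold
      intros; rfl
    have e2 : TensorProduct.map (TensorProduct.map B.inclₗ B.inclₗ) B.inclₗ ∘ₗ
        B.comulRestrict.rTensor B.Carrier =
        (Coalgebra.comul (R := k) (A := A)).rTensor A ∘ₗ TensorProduct.map B.inclₗ B.inclₗ := by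
      rw [LinearMap.map_comp_rTensor, LinearMap.rTensor_comp_map, map_comp_comulRestrict]
    have e3 : TensorProduct.map B.inclₗ (TensorProduct.map B.inclₗ B.inclₗ) ∘ₗ
        B.comulRestrict.lTensor B.Carrier =
        (Coalgebra.comul (R := k) (A := A)).lTensor A ∘ₗ TensorProduct.map B.inclₗ B.inclₗ := by
      rw [LinearMap.map_comp_lTensor, LinearMap.lTensor_comp_map, map_comp_comulRestrict]
    calc _ = (TensorProduct.map B.inclₗ (TensorProduct.map B.inclₗ B.inclₗ) ∘ₗ
        (TensorProduct.assoc k B.Carrier B.Carrier B.Carrier).toLinearMap) ∘ₗ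
          B.comulRestrict.rTensor B.Carrier ∘ₗ B.comulRestrict := rfl
      _ = (TensorProduct.assoc k A A A).toLinearMap ∘ₗ
          (TensorProduct.map (TensorProduct.map B.inclₗ B.inclₗ) B.inclₗ ∘ₗ
            B.comulRestrict.rTensor B.Carrier) ∘ₗ B.comulRestrict := by rw [e1]; rfl
      _ = ((TensorProduct.assoc k A A A).toLinearMap ∘ₗ
          Coalgebra.comul.rTensor A ∘ₗ Coalgebra.comul) ∘ₗ B.inclₗ := by
            rw [e2, LinearMap.comp_assoc, map_comp_comulRestrict]; rfl
      _ = Coalgebra.comul.lTensor A ∘ₗ Coalgebra.comul ∘ₗ B.inclₗ := by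
            rw [Coalgebra.coassoc]; rfl
      _ = (TensorProduct.map B.inclₗ (TensorProduct.map B.inclₗ B.inclₗ) ∘ₗ
          B.comulRestrict.lTensor B.Carrier) ∘ₗ B.comulRestrict := by
            rw [e3, LinearMap.comp_assoc, map_comp_comulRestrict]
      _ = _ := rfl
  rTensor_counit_comp_comul := by
    have hinj : Function.Injective (B.inclₗ.lTensor k) :=
      Module.Flat.lTensor_preserves_injective_linearMap _ B.inclₗ_injective
    refine LinearMap.cancel_left hinj |>.1 ?_
    rw [← LinearMap.comp_assoc, LinearMap.lTensor_comp_rTensor]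
    have : TensorProduct.map (Coalgebra.counit ∘ₗ B.inclₗ) B.inclₗ =
      (Coalgebra.counit (R := k) (A := A)).rTensor A ∘ₗ TensorProduct.map B.inclₗ B.inclₗ := by
      rw [LinearMap.rTensor_comp_map]
    rw [this, LinearMap.comp_assoc, map_comp_comulRestrict, ← LinearMap.comp_assoc,
      Coalgebra.rTensor_counit_comp_comul]
    rfl
  lTensor_counit_comp_comul := by
    have hinj : Function.Injective (B.inclₗ.rTensor k) :=
      Module.Flat.rTensor_preserves_injective_linearMap _ B.inclₗ_injective
    refine LinearMap.cancel_left hinj |>.1 ?_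
    rw [← LinearMap.comp_assoc, LinearMap.rTensor_comp_lTensor]
    have : TensorProduct.map B.inclₗ (Coalgebra.counit ∘ₗ B.inclₗ) =
      (Coalgebra.counit (R := k) (A := A)).lTensor A ∘ₗ TensorProduct.map B.inclₗ B.inclₗ := by
      rw [LinearMap.lTensor_comp_map]
    rw [this, LinearMap.comp_assoc, map_comp_comulRestrict, ← LinearMap.comp_assoc,
      Coalgebra.lTensor_counit_comp_comul]
    rfl

theorem map_comul {k : Type u} {A : Type v} [Field k] [Ring A] [HopfBrace k A]
    (B : SubHopfBrace k A) (b : B.Carrier) :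
    TensorProduct.map B.inclₗ B.inclₗ (Coalgebra.comul b) =
      Coalgebra.comul (R := k) (B.inclₗ b) := B.map_comulRestrict b

instance instBialgebra {k : Type u} {A : Type v} [Field k] [Ring A] [HopfBrace k A]
    (B : SubHopfBrace k A) : Bialgebra k B.Carrier :=
  Bialgebra.mk' k B.Carrier
    (Bialgebra.counit_one (R := k) (A := A))
    (fun {a b} => Bialgebra.counit_mul (R := k) (B.inclₗ a) (B.inclₗ b))
    (by
      apply B.map_inclₗ_injective
      rw [map_comul]
      exact Bialgebra.comul_one (R := k) (A := A))
    (by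
      intro a b
      apply B.map_inclₗ_injective
      have h : ∀ x y : B.Carrier ⊗[k] B.Carrier,
          TensorProduct.map B.inclₗ B.inclₗ (x * y) =
          TensorProduct.map B.inclₗ B.inclₗ x * TensorProduct.map B.inclₗ B.inclₗ y :=
        map_mul (Algebra.TensorProduct.map B.toSubalgebra.val B.toSubalgebra.val)
      rw [h, map_comul, map_comul, map_comul]
      exact Bialgebra.comul_mul (R := k) (B.inclₗ a) (B.inclₗ b))

/-- The restricted antipode `S`. -/
def antipodeRestrict {k : Type u} {A : Type v} [Field k] [Ring A] [HopfBrace k A]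
    (B : SubHopfBrace k A) : B.Carrier →ₗ[k] B.Carrier :=
  (HopfAlgebra.antipode k (A := A)).restrict
    (p := Subalgebra.toSubmodule B.toSubalgebra) (q := Subalgebra.toSubmodule B.toSubalgebra)
    (fun _ h => B.antipode_mem h)

/-- The restricted antipode `T`. -/
def circAntipodeRestrict {k : Type u} {A : Type v} [Field k] [Ring A] [HopfBrace k A]
    (B : SubHopfBrace k A) : B.Carrier →ₗ[k] B.Carrier :=
  (HopfBrace.circAntipode (k := k) (H := A)).restrict
    (p := Subalgebra.toSubmodule B.toSubalgebra) (q := Subalgebra.toSubmodule B.toSubalgebra)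
    (fun _ h => B.circAntipode_mem h)

/-- The restricted product `•`. -/
def circRestrict {k : Type u} {A : Type v} [Field k] [Ring A] [HopfBrace k A]
    (B : SubHopfBrace k A) : B.Carrier →ₗ[k] B.Carrier →ₗ[k] B.Carrier :=
  LinearMap.mk₂ k (fun a b => ⟨HopfBrace.circ (k := k) (a : A) (b : A), B.circ_mem a.2 b.2⟩)
    (fun a b c => Subtype.ext (by simp))
    (fun r a b => Subtype.ext (by simp))
    (fun a b c => Subtype.ext (by simp))
    (fun r a b => Subtype.ext (by simp))

instance instHopfAlgebra {k : Type u} {A : Type v} [Field k] [Ring A] [HopfBrace k A]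
    (B : SubHopfBrace k A) : HopfAlgebra k B.Carrier where
  antipode := B.antipodeRestrict
  mul_antipode_rTensor_comul := by
    refine LinearMap.cancel_left B.inclₗ_injective |>.1 ?_
    have h : B.inclₗ ∘ₗ LinearMap.mul' k B.Carrier ∘ₗ B.antipodeRestrict.rTensor B.Carrier =
        LinearMap.mul' k A ∘ₗ (HopfAlgebra.antipode k (A := A)).rTensor A ∘ₗ
          TensorProduct.map B.inclₗ B.inclₗ := TensorProduct.ext' fun _ _ => rfl
    ext b
    have h1 := LinearMap.congr_fun h (Coalgebra.comul b)
    simp only [LinearMap.comp_apply, map_comul] at h1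
    exact h1.trans (HopfAlgebra.mul_antipode_rTensor_comul_apply (R := k) (B.inclₗ b))
  mul_antipode_lTensor_comul := by
    refine LinearMap.cancel_left B.inclₗ_injective |>.1 ?_
    have h : B.inclₗ ∘ₗ LinearMap.mul' k B.Carrier ∘ₗ B.antipodeRestrict.lTensor B.Carrier =
        LinearMap.mul' k A ∘ₗ (HopfAlgebra.antipode k (A := A)).lTensor A ∘ₗ
          TensorProduct.map B.inclₗ B.inclₗ := TensorProduct.ext' fun _ _ => rfl
    ext b
    have h1 := LinearMap.congr_fun h (Coalgebra.comul b)
    simp only [LinearMap.comp_apply, map_comul] at h1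
    exact h1.trans (HopfAlgebra.mul_antipode_lTensor_comul_apply (R := k) (B.inclₗ b))

/-- A sub-Hopf brace with the restricted operations is a Hopf brace. -/
instance instHopfBrace {k : Type u} {A : Type v} [Field k] [Ring A] [HopfBrace k A]
    (B : SubHopfBrace k A) : HopfBrace k B.Carrier where
  circ := B.circRestrict
  circAntipode := B.circAntipodeRestrict
  circ_assoc := fun a b c =>
    Subtype.ext (HopfBrace.circ_assoc (k := k) (a : A) (b : A) (c : A))
  one_circ := fun a => Subtype.ext (HopfBrace.one_circ (k := k) (a : A))
  circ_one := fun a => Subtype.ext (HopfBrace.circ_one (k := k) (a : A))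
  counit_circ := fun a b => HopfBrace.counit_circ (k := k) (a : A) (b : A)
  comul_circ := by
    intro a b
    apply B.map_inclₗ_injective
    have h : ∀ x y : B.Carrier ⊗[k] B.Carrier,
        TensorProduct.map B.inclₗ B.inclₗ
          (TensorProduct.map₂ B.circRestrict B.circRestrict x y) =
        TensorProduct.map₂ (HopfBrace.circ (k := k)) (HopfBrace.circ (k := k))
          (TensorProduct.map B.inclₗ B.inclₗ x) (TensorProduct.map B.inclₗ B.inclₗ y) := by
      intro x y
      induction x with
      | zero => simp
      | add x x' hx hx' => simp only [map_add, LinearMap.add_apply, hx, hx']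
      | tmul x x' =>
        induction y with
        | zero => simp
        | add y y' hy hy' => simp only [map_add, hy, hy']
        | tmul y y' => rfl
    rw [h]
    erw [map_comul, map_comul, map_comul]
    exact HopfBrace.comul_circ (k := k) (a : A) (b : A)
  circAntipode_circ := by
    intro b
    apply B.inclₗ_injective
    have h : B.inclₗ ∘ₗ TensorProduct.lift B.circRestrict ∘ₗ
        B.circAntipodeRestrict.rTensor B.Carrier =
        TensorProduct.lift (HopfBrace.circ (k := k)) ∘ₗ
          (HopfBrace.circAntipode (k := k) (H := A)).rTensor A ∘ₗ
          TensorProduct.map B.inclₗ B.inclₗ := TensorProduct.ext' fun _ _ => rfl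
    have h1 := LinearMap.congr_fun h (Coalgebra.comul b)
    simp only [LinearMap.comp_apply, map_comul] at h1
    exact h1.trans (HopfBrace.circAntipode_circ (k := k) (B.inclₗ b))
  circ_circAntipode := by
    intro b
    apply B.inclₗ_injective
    have h : B.inclₗ ∘ₗ TensorProduct.lift B.circRestrict ∘ₗ
        B.circAntipodeRestrict.lTensor B.Carrier =
        TensorProduct.lift (HopfBrace.circ (k := k)) ∘ₗ
          (HopfBrace.circAntipode (k := k) (H := A)).lTensor A ∘ₗ
          TensorProduct.map B.inclₗ B.inclₗ := TensorProduct.ext' fun _ _ => rfl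
    have h1 := LinearMap.congr_fun h (Coalgebra.comul b)
    simp only [LinearMap.comp_apply, map_comul] at h1
    exact h1.trans (HopfBrace.circ_circAntipode (k := k) (B.inclₗ b))
  circ_mul := by
    intro a b c
    apply B.inclₗ_injective
    have h : B.inclₗ ∘ₗ LinearMap.mul' k B.Carrier ∘ₗ
        TensorProduct.map (B.circRestrict.flip b)
          (LinearMap.mul' k B.Carrier ∘ₗ
            TensorProduct.map B.antipodeRestrict (B.circRestrict.flip c)) =
        LinearMap.mul' k A ∘ₗ
          TensorProduct.map ((HopfBrace.circ (k := k)).flip (b : A))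
            (LinearMap.mul' k A ∘ₗ TensorProduct.map (HopfAlgebra.antipode k)
              ((HopfBrace.circ (k := k)).flip (c : A))) ∘ₗ
          TensorProduct.map B.inclₗ (TensorProduct.map B.inclₗ B.inclₗ) := by
      apply TensorProduct.ext
      apply LinearMap.ext
      intro x
      apply TensorProduct.ext'
      intro y z
      rfl
    have e3 : TensorProduct.map B.inclₗ (TensorProduct.map B.inclₗ B.inclₗ) ∘ₗ
        (Coalgebra.comul (R := k) (A := B.Carrier)).lTensor B.Carrier =
        (Coalgebra.comul (R := k) (A := A)).lTensor A ∘ₗ TensorProduct.map B.inclₗ B.inclₗ := by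
      rw [LinearMap.map_comp_lTensor, LinearMap.lTensor_comp_map]
      exact congrArg _ B.map_comp_comulRestrict
    have h1 := LinearMap.congr_fun h
      ((Coalgebra.comul (R := k) (A := B.Carrier)).lTensor B.Carrier (Coalgebra.comul a))
    have h2 := LinearMap.congr_fun e3 (Coalgebra.comul a)
    simp only [LinearMap.comp_apply, map_comul] at h1 h2
    rw [h2] at h1
    exact (HopfBrace.circ_mul (k := k) (a : A) (b : A) (c : A)).trans h1.symm

instance instIsCocomm {k : Type u} {A : Type v} [Field k] [Ring A] [HopfBrace k A]
    [Coalgebra.IsCocomm k A] (B : SubHopfBrace k A) : Coalgebra.IsCocomm k B.Carrier where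
  comm_comp_comul := by
    refine LinearMap.cancel_left B.map_inclₗ_injective |>.1 ?_
    have h : TensorProduct.map B.inclₗ B.inclₗ ∘ₗ
        (TensorProduct.comm k B.Carrier B.Carrier).toLinearMap =
        (TensorProduct.comm k A A).toLinearMap ∘ₗ TensorProduct.map B.inclₗ B.inclₗ :=
      TensorProduct.ext' fun _ _ => rfl
    ext b
    have h1 := LinearMap.congr_fun h (Coalgebra.comul b)
    simp only [LinearMap.comp_apply, map_comul] at h1
    refine h1.trans ?_
    exact (Coalgebra.comm_comul k (B.inclₗ b)).trans (B.map_comul b).symm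

/-- The inclusion as a morphism of Hopf braces. -/
def incl {k : Type u} {A : Type v} [Field k] [Ring A] [HopfBrace k A]
    (B : SubHopfBrace k A) : HopfBrace.Hom k B.Carrier A where
  toBialgHom := BialgHom.ofAlgHom B.toSubalgebra.val
    (AlgHom.toLinearMap_injective rfl)
    (AlgHom.toLinearMap_injective B.map_comp_comulRestrict)
  map_circ := fun _ _ => rfl

/-- `B` is *normal*: `a₁ · b · S(a₂) ∈ B`, `a₁ • b • T(a₂) ∈ B` and `a ⇀ b ∈ B` for all `a ∈ A`
and `b ∈ B`. -/
structure IsNormal {k : Type u} {A : Type v} [Field k] [Ring A] [HopfBrace k A]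
    (B : SubHopfBrace k A) : Prop where
  adjoint_mem : ∀ a b : A, b ∈ B.toSubalgebra → HopfBrace.adjoint k a b ∈ B.toSubalgebra
  circAdjoint_mem : ∀ a b : A, b ∈ B.toSubalgebra → HopfBrace.circAdjoint k a b ∈ B.toSubalgebra
  leftAction_mem : ∀ a b : A, b ∈ B.toSubalgebra → HopfBrace.leftAction k a b ∈ B.toSubalgebra

/-- The augmentation part `B⁺ = {b ∈ B | ε(b) = 0}`. -/
def plus {k : Type u} {A : Type v} [Field k] [Ring A] [HopfBrace k A]
    (B : SubHopfBrace k A) : Submodule k A :=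
  Subalgebra.toSubmodule B.toSubalgebra ⊓ LinearMap.ker (Coalgebra.counit (R := k) (A := A))

/-- `A · B⁺`, the linear span of all `a · b` with `a ∈ A` and `b ∈ B⁺`. -/
def mulPlus {k : Type u} {A : Type v} [Field k] [Ring A] [HopfBrace k A]
    (B : SubHopfBrace k A) : Submodule k A :=
  Submodule.map₂ (LinearMap.mul k A) ⊤ B.plus

/-- `A • B⁺`, the linear span of all `a • b` with `a ∈ A` and `b ∈ B⁺`. -/
def circPlus {k : Type u} {A : Type v} [Field k] [Ring A] [HopfBrace k A]
    (B : SubHopfBrace k A) : Submodule k A :=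
  Submodule.map₂ (HopfBrace.circ (k := k) (H := A)) ⊤ B.plus

end SubHopfBrace

/-- Objects of the category of cocommutative Hopf braces over `k`. -/
structure HBRcoc (k : Type u) [Field k] where
  /-- The underlying type. -/
  carrier : Type v
  [ring : Ring carrier]
  [hopfBrace : HopfBrace k carrier]
  [isCocomm : Coalgebra.IsCocomm k carrier]

namespace HBRcoc

attribute [instance] HBRcoc.ring HBRcoc.hopfBrace HBRcoc.isCocomm

/-- The object given by a cocommutative Hopf brace. -/
abbrev of (k : Type u) [Field k] (A : Type v) [Ring A] [HopfBrace k A]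
    [Coalgebra.IsCocomm k A] : HBRcoc.{u, v} k where
  carrier := A

instance category (k : Type u) [Field k] : Category (HBRcoc.{u, v} k) where
  Hom X Y := HopfBrace.Hom k X.carrier Y.carrier
  id X := HopfBrace.Hom.id k X.carrier
  comp f g := HopfBrace.Hom.comp g f

/-- The zero morphisms are the maps `u ∘ ε`. -/
instance hasZeroMorphisms (k : Type u) [Field k] : HasZeroMorphisms (HBRcoc.{u, v} k) where
  zero X Y := ⟨HopfBrace.Hom.zero k X.carrier Y.carrier⟩
  comp_zero := by
    intro X Y f Z
    apply HopfBrace.Hom.ext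
    ext x
    exact congrArg (algebraMap k Z.carrier) (CoalgHomClass.counit_comp_apply f.toBialgHom x)
  zero_comp := by
    intro X Y Z f
    apply HopfBrace.Hom.ext
    ext x
    exact AlgHomClass.commutes f.toBialgHom _

/-- The inclusion of a sub-Hopf brace as a morphism in the category of cocommutative Hopf
braces. -/
def inclusion {k : Type u} {A : Type v} [Field k] [Ring A] [HopfBrace k A]
    [Coalgebra.IsCocomm k A] (B : SubHopfBrace k A) : of k B.Carrier ⟶ of k A :=
  B.incl

end HBRcoc

end

/-!
The implications are proved cyclically: normal ⇒ ideal ⇒ kernel ⇒ normal.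

*Normal ⇒ ideal.* In any Hopf brace `a • b = a₁ · (a₂ ⇀ b)`, and cocommutativity gives the inverse
formula `a · b = a₁ • (T(a₂) ⇀ b)` (`HopfBrace.mul_eq_sum_circ`). As `B⁺` is stable under `⇀`, these
two formulas give `A · B⁺ = A • B⁺`. For a cocommutative Hopf algebra `H` and a subspace `P` stable
under the adjoint action and the antipode, `H P` is a two-sided ideal stable under the antipode,
since `b c = c₁ · (S(c₂) ▷ b)`. This is applied to `A` and to the second Hopf algebra
`HopfBrace.CircAlg k A`, which is a copy of `A` with product `•` and antipode `T`.

*Ideal ⇒ kernel.* Let `π : A → A / A B⁺` be the projection. A morphism `g : D → A` with `π g`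
trivial takes its values in the coinvariants `{x | π(x₁) ⊗ x₂ = π(1) ⊗ x}`, so it must be shown that
coinvariants lie in `B` (`IsSubHopf.mem_of_coinvariant`). This holds as soon as there is a right
`B`-linear map `p : H → B` with `p(1) = 1`: the convolution product `q = p * S` kills `H B⁺`, and
`p = q * id`, so a coinvariant `x` satisfies `x = q(1) x = p(x) ∈ B`.

The retraction `p` (`IsSubHopf.exists_retraction`) is constructed without any structure theorem for
cocommutative Hopf algebras. The dual algebra `H*` is commutative and acts on `H` by
`f • x = x₁ f(x₂)`, and `H` is a locally finite module. For the ideal `J` of the functionals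
vanishing on `B`, Fitting's lemma splits `H` into the elements killed by a power of `J` and the
elements fixed by some element of `J`, and both parts are stable under right multiplication by `B`.
On the second part `p` is zero. The first part is the union of the coradical-like filtration
`W 1 = B ⊆ W 2 ⊆ ⋯` with `Δ(W (n + 1)) ⊆ W n ⊗ H + H ⊗ B`; there a counital linear retraction
`s : H → B` is averaged repeatedly by `p ↦ (x ↦ p(x₁ S(s(x₂)₁)) s(x₂)₂)`. One averaging extends the
range of `B`-linearity from `W n` to `W (n + 1)` without changing the values on `W n`.

*Kernel ⇒ normal.* The coalgebraic kernel `{a | f(a₁) ⊗ a₂ = 1 ⊗ a}` of a morphism `f` of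
cocommutative Hopf braces is itself a sub-Hopf brace on which `f` is trivial, so it is contained in
every sub-Hopf brace that is a categorical kernel of `f`. The adjoint actions and `⇀` are coalgebra
morphisms `A ⊗ A → A` that become trivial on `A ⊗ B` after composition with `f`, hence they map
`A ⊗ B` into the coalgebraic kernel (`CocommHopf.mem_lker_of_trivial`).
-/

/-! ### Primary decomposition of locally finite modules -/

namespace Submodule

variable {R : Type*} {M : Type*} [CommRing R] [AddCommGroup M] [Module R M]

/-- The submodule of elements killed by all `n`-fold products of elements of `J`. -/
def powTorsion (M : Type*) [AddCommGroup M] [Module R M] (J : Ideal R) : ℕ → Submodule R M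
  | 0 => ⊥
  | n + 1 =>
    { carrier := {x | ∀ r ∈ J, r • x ∈ powTorsion M J n}
      add_mem' := fun hx hy r hr => by rw [smul_add]; exact add_mem (hx r hr) (hy r hr)
      zero_mem' := fun r _ => by rw [smul_zero]; exact zero_mem _
      smul_mem' := fun c x hx r hr => by
        rw [smul_comm]; exact Submodule.smul_mem _ c (hx r hr) }

theorem powTorsion_le_succ (J : Ideal R) (n : ℕ) :
    powTorsion M J n ≤ powTorsion M J (n + 1) := by
  induction n with
  | zero => exact bot_le
  | succ n ih => exact fun x hx r hr => ih (hx r hr)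

theorem powTorsion_mono (J : Ideal R) : Monotone (powTorsion M J) :=
  monotone_nat_of_le_succ (powTorsion_le_succ J)

theorem mem_powTorsion_of_forall_pow {J : Ideal R} {n : ℕ} {x : M}
    (h : ∀ r ∈ J ^ n, r • x = 0) : x ∈ powTorsion M J n := by
  induction n generalizing x with
  | zero =>
    have := h 1 (by simp)
    rwa [one_smul] at this
  | succ n ih =>
    intro r hr
    refine ih fun s hs => ?_
    rw [smul_smul]
    exact h _ (by rw [pow_succ]; exact Ideal.mul_mem_mul hs hr)

/-- The submodule of elements killed by some power of `J`. -/
def torsionPart (M : Type*) [AddCommGroup M] [Module R M] (J : Ideal R) : Submodule R M where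
  carrier := {x | ∃ n, x ∈ powTorsion M J n}
  add_mem' := by
    rintro x y ⟨m, hx⟩ ⟨n, hy⟩
    exact ⟨max m n, add_mem (powTorsion_mono J (le_max_left m n) hx)
      (powTorsion_mono J (le_max_right m n) hy)⟩
  zero_mem' := ⟨0, zero_mem _⟩
  smul_mem' := fun c _ ⟨n, hx⟩ => ⟨n, Submodule.smul_mem _ c hx⟩

/-- The submodule of elements fixed by some element of `J`. -/
def fixedPart (M : Type*) [AddCommGroup M] [Module R M] (J : Ideal R) : Submodule R M where
  carrier := {x | ∃ r ∈ J, r • x = x}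
  add_mem' := by
    rintro x y ⟨r, hr, hx⟩ ⟨s, hs, hy⟩
    -- `1 - (r + s - s r) = (1 - r) (1 - s)` kills both `x` and `y`
    refine ⟨r + s - s * r, J.sub_mem (J.add_mem hr hs) (J.mul_mem_left s hr), ?_⟩
    have hx' : (r + s - s * r) • x = x := by
      rw [sub_smul, add_smul, mul_smul, hx]; abel
    have hy' : (r + s - s * r) • y = y := by
      rw [mul_comm, sub_smul, add_smul, mul_smul, hy]; abel
    rw [smul_add, hx', hy']
  zero_mem' := ⟨0, J.zero_mem, smul_zero _⟩
  smul_mem' := by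
    rintro c x ⟨r, hr, hx⟩
    exact ⟨r, hr, by rw [smul_comm, hx]⟩

theorem disjoint_torsionPart_fixedPart (J : Ideal R) :
    Disjoint (torsionPart M J) (fixedPart M J) := by
  rw [Submodule.disjoint_def]
  rintro x ⟨n, hn⟩ ⟨r, hr, hx⟩
  induction n with
  | zero => exact hn
  | succ n ih => exact ih (hx ▸ hn r hr)

/-- Fitting decomposition with respect to an ideal `J`: on a cyclic module of finite length the
chain `J ^ n • ⊤` stabilizes, and by Nakayama's lemma some `r ∈ J` acts as the identity on the
stable value. -/
theorem isCompl_torsionPart_fixedPart (J : Ideal R)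
    (hart : ∀ x : M, IsArtinian R (span R {x})) (hnoe : ∀ x : M, IsNoetherian R (span R {x})) :
    IsCompl (torsionPart M J) (fixedPart M J) := by
  refine ⟨disjoint_torsionPart_fixedPart J, codisjoint_iff_le_sup.2 fun x _ => ?_⟩
  have := hart x
  have := hnoe x
  let N := span R {x}
  obtain ⟨n, hn⟩ := IsArtinian.monotone_stabilizes (R := R) (M := N)
    ⟨fun n => OrderDual.toDual (J ^ n • (⊤ : Submodule R N)),
      fun m n h => Submodule.smul_mono_left (Ideal.pow_le_pow_right h)⟩
  have hst : J ^ n • (⊤ : Submodule R N) = J ^ (n + 1) • (⊤ : Submodule R N) :=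
    hn (n + 1) n.le_succ
  obtain ⟨r, hr, hfix⟩ := exists_mem_and_smul_eq_self_of_fg_of_le_smul J
    (J ^ n • (⊤ : Submodule R N)) (IsNoetherian.noetherian _)
    (by rw [← Submodule.mul_smul, ← pow_succ', ← hst])
  let x' : N := ⟨x, mem_span_singleton_self x⟩
  have key : ∀ s ∈ J ^ n, r • s • x = s • x := fun s hs =>
    congrArg Subtype.val (hfix (s • x') (Submodule.smul_mem_smul hs trivial))
  have hpow : ∀ (m : ℕ) (s : R), s ∈ J ^ n → r ^ m • s • x = s • x := by
    intro m s hs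
    induction m with
    | zero => rw [pow_zero, one_smul]
    | succ m ih => rw [pow_succ, mul_smul, key s hs, ih]
  have h1 : x - r ^ n • x ∈ torsionPart M J := by
    refine ⟨n, mem_powTorsion_of_forall_pow fun s hs => ?_⟩
    rw [smul_sub, smul_comm, hpow n s hs, sub_self]
  have h2 : r ^ n • x ∈ fixedPart M J := ⟨r, hr, key _ (Ideal.pow_mem_pow hr n)⟩
  simpa using Submodule.add_mem_sup h1 h2

end Submodule

/-! ### The action of the dual algebra on a coalgebra -/

namespace TensorProduct

variable {k M N : Type*} [Field k] [AddCommGroup M] [AddCommGroup N] [Module k M] [Module k N]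

/-- A tensor over a field lies in `M ⊗ Y + X ⊗ N` as soon as its slices by the functionals killing
`Y` lie in `X`. -/
theorem mem_sup_of_slices (X : Submodule k M) (Y : Submodule k N) (t : M ⊗[k] N)
    (h : ∀ f : N →ₗ[k] k, (∀ y ∈ Y, f y = 0) → TensorProduct.rid k M (f.lTensor M t) ∈ X) :
    t ∈ LinearMap.range (Y.subtype.lTensor M) ⊔ LinearMap.range (X.subtype.rTensor N) := by
  classical
  -- the right side is the kernel of `M ⊗ N → M/X ⊗ N/Y`; expand in a basis of `N/Y`
  rw [← TensorProduct.map_ker (LinearMap.exact_subtype_mkQ X) X.mkQ_surjective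
    (LinearMap.exact_subtype_mkQ Y) Y.mkQ_surjective, LinearMap.mem_ker]
  let b := Module.Basis.ofVectorSpace k (N ⧸ Y)
  apply (TensorProduct.equivFinsuppOfBasisRight (M := M ⧸ X) b).injective
  rw [map_zero]
  ext i
  have h1 : ∀ t : M ⊗[k] N,
      TensorProduct.equivFinsuppOfBasisRight (M := M ⧸ X) b (TensorProduct.map X.mkQ Y.mkQ t) i =
        X.mkQ (TensorProduct.rid k M ((b.coord i ∘ₗ Y.mkQ).lTensor M t)) := by
    intro t
    induction t with
    | zero => simp
    | add s t hs ht => simp only [map_add, Finsupp.add_apply, hs, ht]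
    | tmul m n => simp
  rw [h1, Finsupp.zero_apply, Submodule.mkQ_apply, Submodule.Quotient.mk_eq_zero]
  refine h _ fun y hy => ?_
  rw [LinearMap.comp_apply, Submodule.mkQ_apply, (Submodule.Quotient.mk_eq_zero Y).2 hy, map_zero]

theorem mem_range_rTensor_of_slices (X : Submodule k M) (t : M ⊗[k] N)
    (h : ∀ f : N →ₗ[k] k, TensorProduct.rid k M (f.lTensor M t) ∈ X) :
    t ∈ LinearMap.range (X.subtype.rTensor N) := by
  have := mem_sup_of_slices X ⊥ t fun f _ => h f
  have h0 : (⊥ : Submodule k N).subtype.lTensor M = 0 := by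
    rw [show (⊥ : Submodule k N).subtype = 0 from
      LinearMap.ext fun x => (Submodule.mem_bot k).1 x.2,
      LinearMap.lTensor_zero]
  rwa [h0, LinearMap.range_zero, bot_sup_eq] at this

end TensorProduct

namespace CoalgebraDual

open Coalgebra (comul counit Repr coassoc_apply IsCocomm)
open scoped Coalgebra

variable {k C : Type*} [Field k] [AddCommGroup C] [Module k C] [Coalgebra k C]

/-- The action `c ↦ c₁ f(c₂)` of a functional on a coalgebra. -/
noncomputable def dualAction (f : C →ₗ[k] k) : C →ₗ[k] C :=
  (TensorProduct.rid k C).toLinearMap ∘ₗ f.lTensor C ∘ₗ comul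

theorem dualAction_eq_sum {ι : Type*} {c : C} (r : Repr k c ι) (f : C →ₗ[k] k) :
    dualAction f c = ∑ i ∈ r.index, f (r.right i) • r.left i := by
  simp [dualAction, ← r.eq]

theorem dualAction_dualAction (f g : C →ₗ[k] k) (c : C) :
    dualAction f (dualAction g c) =
      dualAction (WithConv.toConv f * WithConv.toConv g).ofConv c := by
  have h : ∀ t : C ⊗[k] C, TensorProduct.rid k C (f.lTensor C (comul
      (TensorProduct.rid k C (g.lTensor C t)))) =
      TensorProduct.rid k C (LinearMap.lTensor C (LinearMap.mul' k k ∘ₗ TensorProduct.map f g)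
        (TensorProduct.assoc k C C C (comul.rTensor C t))) := by
    intro t
    induction t with
    | zero => simp
    | add s t hs ht => simp only [map_add, hs, ht]
    | tmul a b =>
      simp only [LinearMap.lTensor_tmul, TensorProduct.rid_tmul, LinearMap.rTensor_tmul, map_smul]
      induction (comul (R := k) a) with
      | zero => simp
      | add s t hs ht => simp only [map_add, smul_add, add_tmul, hs, ht]
      | tmul x y => simp [smul_smul, mul_comm]
  have := h (comul c)
  rw [coassoc_apply] at this
  simp only [dualAction, LinearMap.comp_apply, LinearEquiv.coe_coe]
  rw [this, LinearMap.convMul_def, ← LinearMap.lTensor_comp_apply]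
  rfl

theorem dualAction_counit (c : C) : dualAction (counit (R := k)) c = c := by
  simp [dualAction]

/-- A coalgebra as a module over its dual algebra, by `f • c = c₁ f(c₂)`. -/
noncomputable instance dualModule : Module (WithConv (C →ₗ[k] k)) C where
  smul f c := dualAction f.ofConv c
  one_smul c := dualAction_counit c
  mul_smul f g c := (dualAction_dualAction f.ofConv g.ofConv c).symm
  smul_zero f := map_zero _
  smul_add f := map_add _
  add_smul f g c := by
    change dualAction (f.ofConv + g.ofConv) c = _
    simp only [dualAction, LinearMap.lTensor_add, LinearMap.add_comp, LinearMap.comp_add,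
      LinearMap.add_apply]
    rfl
  zero_smul c := by
    change dualAction (0 : C →ₗ[k] k) c = _
    simp [dualAction]

instance : IsScalarTower k (WithConv (C →ₗ[k] k)) C where
  smul_assoc r f c := by
    change dualAction (r • f.ofConv) c = r • dualAction f.ofConv c
    simp [dualAction, LinearMap.lTensor_smul]

theorem dual_smul_eq_sum {ι : Type*} {c : C} (r : Repr k c ι) (f : WithConv (C →ₗ[k] k)) :
    f • c = ∑ i ∈ r.index, f.ofConv (r.right i) • r.left i := dualAction_eq_sum r _

/-- Every cyclic submodule over the dual algebra is finite-dimensional: it is spanned by the left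
tensor factors of `Δ(c)`. -/
theorem finite_span_singleton (c : C) :
    Module.Finite k ((Submodule.span (WithConv (C →ₗ[k] k)) {c}).restrictScalars k) := by
  classical
  let F : Submodule k C := Submodule.span k ((ℛ k c).index.image (ℛ k c).left : Finset C)
  have hF : (Submodule.span (WithConv (C →ₗ[k] k)) {c}).restrictScalars k ≤ F := by
    intro x hx
    obtain ⟨f, rfl⟩ := Submodule.mem_span_singleton.1 (show x ∈ Submodule.span _ {c} from hx)
    rw [dual_smul_eq_sum (ℛ k c)]
    refine Submodule.sum_mem _ fun i hi => Submodule.smul_mem _ _ (Submodule.subset_span ?_)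
    exact Finset.mem_coe.2 (Finset.mem_image_of_mem _ hi)
  have : Module.Finite k F := Module.Finite.span_finset k _
  exact Submodule.finiteDimensional_of_le hF

variable [IsCocomm k C]

theorem isCompl_torsionPart_fixedPart (J : Ideal (WithConv (C →ₗ[k] k))) :
    IsCompl (Submodule.torsionPart C J) (Submodule.fixedPart C J) :=
  Submodule.isCompl_torsionPart_fixedPart J
    (fun x => isArtinian_of_tower k (by
      have := finite_span_singleton (k := k) x
      exact (inferInstance : IsArtinian k
        ((Submodule.span (WithConv (C →ₗ[k] k)) {x}).restrictScalars k))))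
    (fun x => isNoetherian_of_tower k (by
      have := finite_span_singleton (k := k) x
      exact (inferInstance : IsNoetherian k
        ((Submodule.span (WithConv (C →ₗ[k] k)) {x}).restrictScalars k))))

end CoalgebraDual

/-! ### Retractions onto sub-Hopf algebras -/

namespace TensorProduct

variable {k M N : Type*} [Field k] [AddCommGroup M] [AddCommGroup N] [Module k M] [Module k N]

/-- Over a field, `(X ⊗ N) ∩ (M ⊗ Y) = X ⊗ Y`. -/
theorem mem_range_map_of_mem {X : Submodule k M} {Y : Submodule k N} {t : M ⊗[k] N}
    (hX : t ∈ LinearMap.range (X.subtype.rTensor N))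
    (hY : t ∈ LinearMap.range (Y.subtype.lTensor M)) :
    t ∈ LinearMap.range (TensorProduct.map X.subtype Y.subtype) := by
  obtain ⟨g, hg⟩ := X.subtype.exists_leftInverse_of_injective (Submodule.ker_subtype X)
  obtain ⟨h, hh⟩ := Y.subtype.exists_leftInverse_of_injective (Submodule.ker_subtype Y)
  obtain ⟨x, rfl⟩ := hX
  obtain ⟨y, hy⟩ := hY
  refine ⟨TensorProduct.map LinearMap.id h x, ?_⟩
  have h1 : TensorProduct.map X.subtype Y.subtype (TensorProduct.map LinearMap.id h x) =
      (Y.subtype ∘ₗ h).lTensor M (X.subtype.rTensor N x) := by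
    rw [← LinearMap.comp_apply, ← LinearMap.comp_apply, ← TensorProduct.map_comp,
      LinearMap.lTensor_comp_rTensor]
    rfl
  rw [h1, ← hy, ← LinearMap.comp_apply, ← LinearMap.lTensor_comp, LinearMap.comp_assoc, hh]
  rfl

end TensorProduct

namespace CoalgebraDual

open Coalgebra (comul counit Repr coassoc_apply IsCocomm)
open scoped Coalgebra

section Coalgebra

variable {k C : Type*} [Field k] [AddCommGroup C] [Module k C] [Coalgebra k C]

/-- If `Δ(c) ∈ X ⊗ Y`, then `Δ(c)` has a representation with left factors in `X` and right
factors in `Y`. -/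
theorem exists_repr_of_mem_range {X Y : Submodule k C} {c : C}
    (hc : comul (R := k) c ∈ LinearMap.range (TensorProduct.map X.subtype Y.subtype)) :
    ∃ r : Repr k c (X × Y), ∀ i, r.left i ∈ X ∧ r.right i ∈ Y := by
  obtain ⟨t, ht⟩ := hc
  obtain ⟨S, hS⟩ := TensorProduct.exists_finset t
  refine ⟨⟨S, fun i => i.1, fun i => i.2, ?_⟩, fun i => ⟨i.1.2, i.2.2⟩⟩
  rw [← ht, hS]
  simp

theorem comul_mem_rTensor (X : Submodule (WithConv (C →ₗ[k] k)) C) {x : C} (hx : x ∈ X) :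
    comul (R := k) x ∈ LinearMap.range ((X.restrictScalars k).subtype.rTensor C) :=
  TensorProduct.mem_range_rTensor_of_slices _ _ fun f => X.smul_mem (WithConv.toConv f) hx

variable [IsCocomm k C]

/-- In a cocommutative coalgebra, left coideals are subcoalgebras. -/
theorem comul_mem_map_of_mem_rTensor {X : Submodule k C} {x : C}
    (h : comul (R := k) x ∈ LinearMap.range (X.subtype.rTensor C)) :
    comul (R := k) x ∈ LinearMap.range (TensorProduct.map X.subtype X.subtype) := by
  refine TensorProduct.mem_range_map_of_mem h ?_
  obtain ⟨t, ht⟩ := h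
  refine ⟨TensorProduct.comm k _ _ t, ?_⟩
  rw [← Coalgebra.comm_comul k x, ← ht]
  exact (LinearMap.congr_fun (LinearMap.comm_comp_rTensor_comp_comm_eq _) _ ).symm.trans (by simp)

theorem comul_mem_map (X : Submodule (WithConv (C →ₗ[k] k)) C) {x : C} (hx : x ∈ X) :
    comul (R := k) x ∈ LinearMap.range
      (TensorProduct.map (X.restrictScalars k).subtype (X.restrictScalars k).subtype) :=
  comul_mem_map_of_mem_rTensor (comul_mem_rTensor X hx)

end Coalgebra

section Hopf

variable {k H : Type*} [Field k] [Ring H] [HopfAlgebra k H]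

local notation "S" => HopfAlgebra.antipode k (A := H)

/-- `b₁ ⊗ b₂ S(b₃) = b ⊗ 1`. -/
theorem comul_mul_antipode_right (b : H) :
    (LinearMap.mul' k H ∘ₗ (S).lTensor H).lTensor H
      (TensorProduct.assoc k H H H ((comul (R := k)).rTensor H (comul (R := k) b))) = b ⊗ₜ 1 := by
  rw [coassoc_apply, ← LinearMap.lTensor_comp_apply, LinearMap.comp_assoc,
    HopfAlgebra.mul_antipode_lTensor_comul, LinearMap.lTensor_comp_apply,
    Coalgebra.lTensor_counit_comul]
  simp

/-- `b₁ S(b₂) ⊗ b₃ = 1 ⊗ b`. -/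
theorem comul_mul_antipode_left (b : H) :
    (LinearMap.mul' k H ∘ₗ (S).lTensor H).rTensor H
      ((TensorProduct.assoc k H H H).symm ((comul (R := k)).lTensor H (comul (R := k) b))) =
      1 ⊗ₜ b := by
  rw [Coalgebra.coassoc_symm_apply, ← LinearMap.rTensor_comp_apply, LinearMap.comp_assoc,
    HopfAlgebra.mul_antipode_lTensor_comul, LinearMap.rTensor_comp_apply,
    Coalgebra.rTensor_counit_comul]
  simp

/-- `f • (x b) = ∑ (f(- b₂) • x) b₁`. -/
theorem smul_mul_eq_sum {ι : Type*} (f : WithConv (H →ₗ[k] k)) (x : H) {b : H} (r : Repr k b ι) :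
    f • (x * b) = ∑ j ∈ r.index,
      (WithConv.toConv (f.ofConv ∘ₗ LinearMap.mulRight k (r.right j)) • x) * r.left j := by
  rw [dual_smul_eq_sum ((ℛ k x).mul r)]
  simp only [dual_smul_eq_sum (ℛ k x), Coalgebra.Repr.mul_index, Coalgebra.Repr.mul_left,
    Coalgebra.Repr.mul_right, Finset.sum_product, Finset.sum_mul, smul_mul_assoc]
  rw [Finset.sum_comm]
  simp

/-- `(f • x) b = ∑ f(- S(b₂)) • (x b₁)`. -/
theorem smul_mul_eq_sum_smul {ι : Type*} (f : WithConv (H →ₗ[k] k)) (x : H) {b : H}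
    (r : Repr k b ι) :
    (f • x) * b = ∑ j ∈ r.index,
      WithConv.toConv (f.ofConv ∘ₗ LinearMap.mulRight k (S (r.right j))) • (x * r.left j) := by
  let G : H ⊗[k] H →ₗ[k] H := ∑ i ∈ (ℛ k x).index, TensorProduct.lift
    (LinearMap.mk₂ k (fun u v => f.ofConv ((ℛ k x).right i * v) • ((ℛ k x).left i * u))
      (by intros; simp [mul_add]) (by intros; rw [mul_smul_comm, smul_comm])
      (by intros; simp [mul_add, add_smul])
      (by intros; simp only [mul_smul_comm, map_smul, smul_assoc]))
  have hG : ∀ u v, G (u ⊗ₜ v) =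
      (WithConv.toConv (f.ofConv ∘ₗ LinearMap.mulRight k v) • x) * u := by
    intro u v
    simp [G, dual_smul_eq_sum (ℛ k x), Finset.sum_mul, LinearMap.sum_apply]
  have h := congrArg G (comul_mul_antipode_right (k := k) b)
  rw [hG, LinearMap.mulRight_one, LinearMap.comp_id] at h
  rw [show WithConv.toConv f.ofConv = f from rfl] at h
  rw [← h, ← r.eq, map_sum, map_sum, map_sum, map_sum]
  refine Finset.sum_congr rfl fun j _ => ?_
  rw [smul_mul_eq_sum _ _ (ℛ k (r.left j)), LinearMap.rTensor_tmul, ← (ℛ k (r.left j)).eq,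
    TensorProduct.sum_tmul, map_sum, map_sum, map_sum]
  refine Finset.sum_congr rfl fun l _ => ?_
  rw [TensorProduct.assoc_tmul, LinearMap.lTensor_tmul, hG]
  congr 2
  ext y
  simp [mul_assoc]

end Hopf

end CoalgebraDual

open Coalgebra (comul counit Repr IsCocomm)
open scoped Coalgebra
open CoalgebraDual

/-- A subspace `B` of a Hopf algebra is a sub-Hopf algebra: it is closed under the unit, the product
and the antipode, and `Δ(B) ⊆ B ⊗ B`. -/
structure IsSubHopf {k H : Type*} [Field k] [Ring H] [HopfAlgebra k H] (B : Submodule k H) :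
    Prop where
  one_mem : (1 : H) ∈ B
  mul_mem : ∀ {a b : H}, a ∈ B → b ∈ B → a * b ∈ B
  antipode_mem : ∀ {a : H}, a ∈ B → HopfAlgebra.antipode k a ∈ B
  comul_mem : ∀ {a : H}, a ∈ B →
    comul (R := k) a ∈ LinearMap.range (TensorProduct.map B.subtype B.subtype)

namespace IsSubHopf

variable {k H : Type*} [Field k] [Ring H] [HopfAlgebra k H]

local notation "S" => HopfAlgebra.antipode k (A := H)

variable {B : Submodule k H} (hB : IsSubHopf B)
include hB

theorem exists_repr {b : H} (hb : b ∈ B) :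
    ∃ r : Repr k b (B × B), ∀ i, r.left i ∈ B ∧ r.right i ∈ B :=
  exists_repr_of_mem_range (hB.comul_mem hb)

theorem span_singleton_le {b : H} (hb : b ∈ B) :
    (Submodule.span (WithConv (H →ₗ[k] k)) {b}).restrictScalars k ≤ B := by
  intro c hc
  obtain ⟨f, rfl⟩ := Submodule.mem_span_singleton.1 (show c ∈ Submodule.span _ {b} from hc)
  obtain ⟨r, hr⟩ := hB.exists_repr hb
  rw [dual_smul_eq_sum r]
  exact Submodule.sum_mem _ fun i _ => B.smul_mem _ (hr i).1

/-- The functionals vanishing on `B` form an ideal of the dual algebra. -/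
def annihilator [IsCocomm k H] : Ideal (WithConv (H →ₗ[k] k)) where
  carrier := {f | ∀ b ∈ B, f.ofConv b = 0}
  add_mem' := fun hf hg b hb => by simp [hf b hb, hg b hb]
  zero_mem' := fun b _ => rfl
  smul_mem' := fun g f hf b hb => by
    obtain ⟨r, hr⟩ := hB.exists_repr hb
    change (g * f) b = 0
    rw [r.convMul_apply]
    exact Finset.sum_eq_zero fun i _ => by
      rw [show f (r.right i) = 0 from hf _ (hr i).2, mul_zero]

variable [IsCocomm k H]

theorem mulRight_mem_annihilator {f : WithConv (H →ₗ[k] k)} (hf : f ∈ hB.annihilator) {b : H}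
    (hb : b ∈ B) : WithConv.toConv (f.ofConv ∘ₗ LinearMap.mulRight k b) ∈ hB.annihilator :=
  fun c hc => hf (c * b) (hB.mul_mem hc hb)

theorem powTorsion_mul_mem {n : ℕ} {x b : H} (hx : x ∈ Submodule.powTorsion H hB.annihilator n)
    (hb : b ∈ B) : x * b ∈ Submodule.powTorsion H hB.annihilator n := by
  induction n generalizing x b with
  | zero => rw [show x = 0 from hx, zero_mul]; exact zero_mem _
  | succ n ih =>
    intro f hf
    obtain ⟨r, hr⟩ := hB.exists_repr hb
    rw [smul_mul_eq_sum f x r]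
    exact Submodule.sum_mem _ fun j _ =>
      ih (hx _ (hB.mulRight_mem_annihilator hf (hr j).2)) (hr j).1

theorem torsionPart_mul_mem {x b : H} (hx : x ∈ Submodule.torsionPart H hB.annihilator)
    (hb : b ∈ B) : x * b ∈ Submodule.torsionPart H hB.annihilator :=
  hx.imp fun _ h => hB.powTorsion_mul_mem h hb

/-- The fixed part is stable under right multiplication by `B`: for `f ∈ J` with `f • x = x`, the
finite-dimensional submodule `P = (H* • x) (H* • b)` satisfies `P = J • P` because
`y b = (f • y) b = ∑ f(- S(b₂)) • (y b₁)`, and Nakayama's lemma applies. -/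
theorem fixedPart_mul_mem {x b : H} (hx : x ∈ Submodule.fixedPart H hB.annihilator)
    (hb : b ∈ B) : x * b ∈ Submodule.fixedPart H hB.annihilator := by
  obtain ⟨f, hf, hfx⟩ := hx
  let X := Submodule.span (WithConv (H →ₗ[k] k)) {x}
  let Y := Submodule.span (WithConv (H →ₗ[k] k)) {b}
  have hY : Y.restrictScalars k ≤ B := hB.span_singleton_le hb
  have hfX : ∀ y ∈ X, f • y = y := fun y hy => by
    obtain ⟨g, rfl⟩ := Submodule.mem_span_singleton.1 hy
    rw [smul_comm, hfx]
  have hrepr : ∀ y ∈ Y, ∃ r : Repr k y (Y.restrictScalars k × Y.restrictScalars k),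
      ∀ i, r.left i ∈ Y ∧ r.right i ∈ Y := fun y hy =>
    exists_repr_of_mem_range (comul_mem_map Y hy)
  let P₀ : Submodule k H := X.restrictScalars k * Y.restrictScalars k
  let P : Submodule (WithConv (H →ₗ[k] k)) H :=
    { P₀ with
      smul_mem' := fun g p hp => by
        refine Submodule.mul_induction_on (C := fun p => g • p ∈ P₀) hp ?_ ?_
        · intro y hy z hz
          obtain ⟨r, hr⟩ := hrepr z hz
          rw [smul_mul_eq_sum g y r]
          exact Submodule.sum_mem _ fun j _ =>
            Submodule.mul_mem_mul (X.smul_mem _ hy) (hr j).1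
        · intro y z hy hz
          rw [smul_add]
          exact P₀.add_mem hy hz }
  have hPfg : P.FG := by
    refine Submodule.FG.of_restrictScalars k ?_
    have hX' := finite_span_singleton (k := k) x
    have hY' := finite_span_singleton (k := k) b
    exact Submodule.FG.mul (Module.Finite.iff_fg.1 hX') (Module.Finite.iff_fg.1 hY')
  have hPJ : P ≤ hB.annihilator • P := by
    intro p hp
    refine Submodule.mul_induction_on (C := fun p => p ∈ hB.annihilator • P)
      (show p ∈ P₀ from hp) ?_ fun y z hy hz => add_mem hy hz
    intro y hy z hz
    obtain ⟨r, hr⟩ := hrepr z hz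
    rw [← hfX y hy, smul_mul_eq_sum_smul f y r]
    exact Submodule.sum_mem _ fun j _ => Submodule.smul_mem_smul
      (hB.mulRight_mem_annihilator hf (hB.antipode_mem (hY (hr j).2)))
      (show _ ∈ P₀ from Submodule.mul_mem_mul hy (hr j).1)
  obtain ⟨r, hr, hfix⟩ := Submodule.exists_mem_and_smul_eq_self_of_fg_of_le_smul _ P hPfg hPJ
  exact ⟨r, hr, hfix _ (show _ ∈ P₀ from Submodule.mul_mem_mul
    (Submodule.mem_span_singleton_self x) (Submodule.mem_span_singleton_self b))⟩

/-- The part of `H` killed by the annihilator of `B` is `B`. -/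
theorem mem_powTorsion_one {x : H} : x ∈ Submodule.powTorsion H hB.annihilator 1 ↔ x ∈ B := by
  constructor
  · intro hx
    have h := TensorProduct.mem_sup_of_slices (⊥ : Submodule k H) B (comul x)
      fun f hf => hx (WithConv.toConv f) hf
    have h0 : (⊥ : Submodule k H).subtype.rTensor H = 0 := by
      rw [show (⊥ : Submodule k H).subtype = 0 from
        LinearMap.ext fun x => (Submodule.mem_bot k).1 x.2, LinearMap.rTensor_zero]
    rw [h0, LinearMap.range_zero, sup_bot_eq] at h
    obtain ⟨t, ht⟩ := h
    have hx' : x = TensorProduct.lid k H ((counit (R := k)).rTensor H (comul x)) := by simp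
    rw [hx', ← ht]
    clear ht hx'
    induction t with
    | zero => simp
    | add s t hs ht => rw [map_add, map_add, map_add]; exact B.add_mem hs ht
    | tmul a b => simpa using B.smul_mem _ b.2
  · intro hx f hf
    obtain ⟨r, hr⟩ := hB.exists_repr hx
    rw [dual_smul_eq_sum r]
    exact Submodule.sum_mem _ fun i _ => by
      rw [hf _ (hr i).2, zero_smul]; exact zero_mem _

theorem comul_mem_of_mem_powTorsion_succ {n : ℕ} {x : H}
    (hx : x ∈ Submodule.powTorsion H hB.annihilator (n + 1)) :
    comul (R := k) x ∈ LinearMap.range (B.subtype.lTensor H) ⊔ LinearMap.range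
      (((Submodule.powTorsion H hB.annihilator n).restrictScalars k).subtype.rTensor H) :=
  TensorProduct.mem_sup_of_slices _ _ _ fun f hf => hx (WithConv.toConv f) hf

end IsSubHopf

section Averaging

variable {k H : Type*} [Field k] [Ring H] [HopfAlgebra k H]

local notation "S" => HopfAlgebra.antipode k (A := H)

/-- The map `a ⊗ c ↦ p(a S(c₁)) c₂`. -/
noncomputable def hopfTranslate (p : H →ₗ[k] H) : H ⊗[k] H →ₗ[k] H :=
  LinearMap.mul' k H ∘ₗ (p ∘ₗ LinearMap.mul' k H ∘ₗ (S).lTensor H).rTensor H ∘ₗ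
    (TensorProduct.assoc k H H H).symm.toLinearMap ∘ₗ (comul (R := k)).lTensor H

theorem hopfTranslate_tmul {ι : Type*} (p : H →ₗ[k] H) (a : H) {c : H} (r : Repr k c ι) :
    hopfTranslate p (a ⊗ₜ c) = ∑ i ∈ r.index, p (a * S (r.left i)) * r.right i := by
  simp [hopfTranslate, ← r.eq, TensorProduct.tmul_sum]

/-- `hopfTranslate p` is right `H`-linear for the diagonal action of `H` on `H ⊗ H`. -/
theorem hopfTranslate_mul_comul (p : H →ₗ[k] H) (t : H ⊗[k] H) (b : H) :
    hopfTranslate p (t * comul (R := k) b) = hopfTranslate p t * b := by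
  induction t with
  | zero => simp
  | add s t hs ht => simp only [add_mul, map_add, hs, ht]
  | tmul a c =>
    let G : H ⊗[k] H →ₗ[k] H := ∑ i ∈ (ℛ k c).index, TensorProduct.lift
      (LinearMap.mk₂ k (fun u v => p (a * u * S ((ℛ k c).left i)) * ((ℛ k c).right i * v))
        (by intros; simp [mul_add, add_mul]) (by intros; simp)
        (by intros; simp [mul_add]) (by intros; simp))
    have hG : ∀ u v, G (u ⊗ₜ v) = ∑ i ∈ (ℛ k c).index,
        p (a * u * S ((ℛ k c).left i)) * ((ℛ k c).right i * v) := by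
      intro u v
      simp [G, LinearMap.sum_apply]
    have h := congrArg G (comul_mul_antipode_left (k := k) b)
    rw [hG] at h
    rw [hopfTranslate_tmul p a (ℛ k c), Finset.sum_mul]
    simp only [mul_one, mul_assoc] at h ⊢
    rw [← h]
    clear h
    rw [← (ℛ k b).eq, Finset.mul_sum, map_sum, map_sum, map_sum, map_sum, map_sum]
    refine Finset.sum_congr rfl fun j _ => ?_
    rw [Algebra.TensorProduct.tmul_mul_tmul,
      hopfTranslate_tmul p _ ((ℛ k c).mul (ℛ k ((ℛ k b).right j))),
      LinearMap.lTensor_tmul, ← (ℛ k ((ℛ k b).right j)).eq,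
      TensorProduct.tmul_sum, map_sum, map_sum, map_sum]
    simp only [Coalgebra.Repr.mul_index, Coalgebra.Repr.mul_left, Coalgebra.Repr.mul_right,
      Finset.sum_product, TensorProduct.assoc_symm_tmul, LinearMap.rTensor_tmul, hG,
      HopfAlgebra.antipode_mul_antidistrib, LinearMap.comp_apply, LinearMap.lTensor_tmul,
      LinearMap.mul'_apply]
    rw [Finset.sum_comm]
    simp only [mul_assoc]

/-- The averaged map `y ↦ p(y₁ S(s(y₂)₁)) s(y₂)₂`. If `s` is a projection onto a sub-Hopf algebra
`B`, this is the Hopf-module averaging of `p`, which turns linear maps into `B`-linear ones. -/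
noncomputable def hopfAverage (s p : H →ₗ[k] H) : H →ₗ[k] H :=
  hopfTranslate p ∘ₗ s.lTensor H ∘ₗ comul (R := k)

end Averaging

namespace IsSubHopf

variable {k H : Type*} [Field k] [Ring H] [HopfAlgebra k H]

local notation "S" => HopfAlgebra.antipode k (A := H)

variable {B : Submodule k H} (hB : IsSubHopf B)
include hB

/-- There is a linear retraction onto `B` that preserves the counit. -/
theorem exists_counital_retraction :
    ∃ s : H →ₗ[k] H, (∀ x, s x ∈ B) ∧ (∀ b ∈ B, s b = b) ∧
      ∀ x, counit (R := k) (s x) = counit (R := k) x := by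
  obtain ⟨g, hg⟩ := B.subtype.exists_leftInverse_of_injective (Submodule.ker_subtype B)
  refine ⟨B.subtype ∘ₗ g + ((counit (R := k)) ∘ₗ (LinearMap.id - B.subtype ∘ₗ g)).smulRight 1,
    fun x => ?_, fun b hb => ?_, fun x => ?_⟩
  · exact B.add_mem (g x).2 (B.smul_mem _ hB.one_mem)
  · have : g b = ⟨b, hb⟩ := LinearMap.congr_fun hg ⟨b, hb⟩
    simp [this]
  · simp

theorem hopfTranslate_mem {p : H →ₗ[k] H} (hp : ∀ x, p x ∈ B) (x : H) {b : H}
    (hb : b ∈ B) : hopfTranslate p (x ⊗ₜ b) ∈ B := by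
  obtain ⟨r, hr⟩ := hB.exists_repr hb
  rw [hopfTranslate_tmul p x r]
  exact B.sum_mem fun i _ => hB.mul_mem (hp _) (hr i).2

theorem hopfAverage_mem {s p : H →ₗ[k] H} (hs : ∀ x, s x ∈ B) (hp : ∀ x, p x ∈ B) (x : H) :
    hopfAverage s p x ∈ B := by
  rw [hopfAverage, LinearMap.comp_apply, LinearMap.comp_apply, ← (ℛ k x).eq, map_sum, map_sum]
  exact B.sum_mem fun i _ => hB.hopfTranslate_mem hp _ (hs _)

theorem hopfTranslate_of_linear {p : H →ₗ[k] H} {x : H} (hx : ∀ b ∈ B, p (x * b) = p x * b) {b : H}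
    (hb : b ∈ B) : hopfTranslate p (x ⊗ₜ b) = counit (R := k) b • p x := by
  obtain ⟨r, hr⟩ := hB.exists_repr hb
  rw [hopfTranslate_tmul p x r]
  calc _ = p x * ∑ i ∈ r.index, S (r.left i) * r.right i := by
        rw [Finset.mul_sum]
        exact Finset.sum_congr rfl fun i _ => by
          rw [hx _ (hB.antipode_mem (hr i).1), mul_assoc]
    _ = _ := by rw [HopfAlgebra.sum_antipode_mul_eq_smul, mul_smul_comm, mul_one]

variable {s p : H →ₗ[k] H} (hs : ∀ x, s x ∈ B)
  (hsε : ∀ x, counit (R := k) (s x) = counit (R := k) x)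
include hs hsε

/-- Averaging does not change `p` where it is already `B`-linear. -/
theorem hopfAverage_eq {X : Submodule k H} (hX : ∀ x ∈ X, ∀ b ∈ B, p (x * b) = p x * b)
    (hXΔ : ∀ x ∈ X, comul (R := k) x ∈ LinearMap.range (X.subtype.rTensor H))
    {x : H} (hx : x ∈ X) : hopfAverage s p x = p x := by
  have h : ∀ t : X ⊗[k] H, hopfTranslate p (s.lTensor H (X.subtype.rTensor H t)) =
      p (TensorProduct.rid k H ((counit (R := k)).lTensor H (X.subtype.rTensor H t))) := by
    intro t
    induction t with
    | zero => simp
    | add s t hs ht => simp only [map_add, hs, ht]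
    | tmul y c =>
      simp only [LinearMap.rTensor_tmul, LinearMap.lTensor_tmul, TensorProduct.rid_tmul, map_smul,
        Submodule.subtype_apply]
      rw [hB.hopfTranslate_of_linear (hX _ y.2) (hs c), hsε]
  obtain ⟨t, ht⟩ := hXΔ x hx
  rw [hopfAverage, LinearMap.comp_apply, LinearMap.comp_apply, ← ht, h, ht]
  simp

/-- If `p` is `B`-linear on `X`, then its average is `B`-linear on the elements `y` with
`Δ(y) ∈ X ⊗ H + H ⊗ B`. -/
theorem hopfAverage_mul (hsB : ∀ b ∈ B, s b = b) {X : Submodule k H}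
    (hX : ∀ x ∈ X, ∀ b ∈ B, p (x * b) = p x * b) (hXB : ∀ x ∈ X, ∀ b ∈ B, x * b ∈ X) {y : H}
    (hy : comul (R := k) y ∈
      LinearMap.range (B.subtype.lTensor H) ⊔ LinearMap.range (X.subtype.rTensor H))
    {b : H} (hb : b ∈ B) : hopfAverage s p (y * b) = hopfAverage s p y * b := by
  obtain ⟨r, hr⟩ := hB.exists_repr hb
  have h1 : ∀ t : H ⊗[k] B,
      hopfTranslate p (s.lTensor H (B.subtype.lTensor H t * comul (R := k) b)) =
      hopfTranslate p (s.lTensor H (B.subtype.lTensor H t)) * b := by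
    intro t
    induction t with
    | zero => simp
    | add s t hs ht => simp only [map_add, add_mul, hs, ht]
    | tmul z c =>
      have e1 : s.lTensor H (B.subtype.lTensor H (z ⊗ₜ c)) = z ⊗ₜ (c : H) := by
        simp [hsB c c.2]
      have e2 : s.lTensor H (B.subtype.lTensor H (z ⊗ₜ c) * comul (R := k) b) =
          (z ⊗ₜ (c : H)) * comul (R := k) b := by
        rw [← r.eq, Finset.mul_sum, Finset.mul_sum, map_sum]
        refine Finset.sum_congr rfl fun i _ => ?_
        simp [hsB _ (hB.mul_mem c.2 (hr i).2)]
      rw [e1, e2, hopfTranslate_mul_comul]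
  have h2 : ∀ t : X ⊗[k] H,
      hopfTranslate p (s.lTensor H (X.subtype.rTensor H t * comul (R := k) b)) =
      hopfTranslate p (s.lTensor H (X.subtype.rTensor H t)) * b := by
    intro t
    induction t with
    | zero => simp
    | add s t hs ht => simp only [map_add, add_mul, hs, ht]
    | tmul x a =>
      rw [LinearMap.rTensor_tmul, LinearMap.lTensor_tmul, Submodule.subtype_apply,
        hB.hopfTranslate_of_linear (hX _ x.2) (hs a), hsε, ← r.eq, Finset.mul_sum, map_sum, map_sum]
      calc _ = ∑ i ∈ r.index,
            counit (R := k) a • (p x * (counit (R := k) (r.right i) • r.left i)) := by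
            refine Finset.sum_congr rfl fun i _ => ?_
            rw [Algebra.TensorProduct.tmul_mul_tmul, LinearMap.lTensor_tmul,
              hB.hopfTranslate_of_linear (hX _ (hXB _ x.2 _ (hr i).1)) (hs _), hsε,
              Bialgebra.counit_mul, hX _ x.2 _ (hr i).1, mul_smul, mul_smul_comm]
        _ = _ := by
            rw [← Finset.smul_sum, ← Finset.mul_sum]
            rw [← dualAction_eq_sum r (counit (R := k)), dualAction_counit, smul_mul_assoc]
  obtain ⟨t₁, ⟨u, rfl⟩, t₂, ⟨w, rfl⟩, ht⟩ := Submodule.mem_sup.1 hy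
  simp only [hopfAverage, LinearMap.comp_apply]
  rw [Bialgebra.comul_mul, ← ht, add_mul, map_add, map_add, h1, h2, map_add, map_add, add_mul]

end IsSubHopf

namespace IsSubHopf

variable {k H : Type*} [Field k] [Ring H] [HopfAlgebra k H] [IsCocomm k H]
variable {B : Submodule k H}

/-- The torsion part of `H` admits a `B`-linear retraction onto `B`: a linear retraction is averaged
along the filtration `powTorsion`, and the values stabilize on each step of the filtration. -/
theorem exists_retraction_torsionPart (hB : IsSubHopf B) :
    ∃ p : (Submodule.torsionPart H hB.annihilator).restrictScalars k →ₗ[k] H,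
      (∀ x, p x ∈ B) ∧ (∀ x ∈ B, ∀ hx, p ⟨x, hx⟩ = x) ∧
      ∀ x, ∀ b ∈ B, ∀ hx hxb, p ⟨x * b, hxb⟩ = p ⟨x, hx⟩ * b := by
  obtain ⟨s, hs, hsB, hsε⟩ := hB.exists_counital_retraction
  let W : ℕ → Submodule k H := fun n =>
    (Submodule.powTorsion H hB.annihilator n).restrictScalars k
  have hWB : ∀ n, ∀ x ∈ W n, ∀ b ∈ B, x * b ∈ W n := fun n x hx b hb =>
    hB.powTorsion_mul_mem hx hb
  have hW1 : ∀ x, x ∈ W 1 ↔ x ∈ B := fun x => hB.mem_powTorsion_one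
  have hWmono : Monotone W := fun m n h x hx => Submodule.powTorsion_mono _ h hx
  let P : ℕ → H →ₗ[k] H := fun n => (hopfAverage s)^[n] s
  have hPsucc : ∀ n, P (n + 1) = hopfAverage s (P n) := fun n =>
    Function.iterate_succ_apply' _ _ _
  have hPB : ∀ n x, P n x ∈ B := fun n => by
    induction n with
    | zero => exact hs
    | succ n ih => rw [hPsucc]; exact hB.hopfAverage_mem hs ih
  have hPlin : ∀ n, ∀ x ∈ W (n + 1), ∀ b ∈ B, P n (x * b) = P n x * b := fun n => by
    induction n with
    | zero =>
      intro x hx b hb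
      have hx' := (hW1 x).1 hx
      change s (x * b) = s x * b
      rw [hsB _ hx', hsB _ (hB.mul_mem hx' hb)]
    | succ n ih =>
      intro x hx b hb
      rw [hPsucc]
      exact hB.hopfAverage_mul hs hsε hsB ih (hWB (n + 1))
        (hB.comul_mem_of_mem_powTorsion_succ hx) hb
  have hPstep : ∀ n, ∀ x ∈ W (n + 1), P (n + 1) x = P n x := fun n x hx => by
    rw [hPsucc]
    exact hB.hopfAverage_eq hs hsε (hPlin n) (fun y hy => comul_mem_rTensor _ hy) hx
  have hPstable : ∀ m n, m ≤ n → ∀ x ∈ W (m + 1), P n x = P m x := fun m n h x hx => by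
    induction n, h using Nat.le_induction with
    | base => rfl
    | succ n hmn ih => rw [hPstep n x (hWmono (by omega) hx), ih]
  -- the limit of the maps `P n`: near `x` the sequence is constant from the index `N x` on
  let N : (Submodule.torsionPart H hB.annihilator).restrictScalars k → ℕ := fun x => x.2.choose
  have hN : ∀ x n, N x ≤ n → (x : H) ∈ W n := fun x n h => hWmono h x.2.choose_spec
  have hPN : ∀ x n, N x ≤ n → P n x = P (N x) x := fun x n h =>
    hPstable _ _ h _ (hN x _ (Nat.le_succ _))
  refine ⟨⟨⟨fun x => P (N x) x, fun x y => ?_⟩, fun c x => ?_⟩, fun x => hPB _ _,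
    fun x hxB hx => ?_, fun x b hb hx hxb => ?_⟩
  · have h1 := hPN (x + y) (max (N (x + y)) (max (N x) (N y))) (le_max_left _ _)
    have h2 := hPN x (max (N (x + y)) (max (N x) (N y))) (by omega)
    have h3 := hPN y (max (N (x + y)) (max (N x) (N y))) (by omega)
    rw [← h1, ← h2, ← h3, ← map_add]
    rfl
  · have h1 := hPN (c • x) (max (N (c • x)) (N x)) (le_max_left _ _)
    have h2 := hPN x (max (N (c • x)) (N x)) (le_max_right _ _)
    change P (N (c • x)) ((c • x : _) : H) = c • P (N x) x
    rw [← h1, ← h2, ← map_smul]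
    rfl
  · change P (N ⟨x, hx⟩) x = x
    rw [hPstable 0 (N ⟨x, hx⟩) (Nat.zero_le _) x ((hW1 _).2 hxB)]
    exact hsB _ hxB
  · let n := max (N ⟨x, hx⟩) (N ⟨x * b, hxb⟩)
    have h1 : P n (x * b) = P (N ⟨x * b, hxb⟩) (x * b) := hPN ⟨x * b, hxb⟩ n (le_max_right _ _)
    have h2 : P n x = P (N ⟨x, hx⟩) x := hPN ⟨x, hx⟩ n (le_max_left _ _)
    change P (N ⟨x * b, hxb⟩) (x * b) = P (N ⟨x, hx⟩) x * b
    rw [← h1, ← h2]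
    exact hPlin n x (hN ⟨x, hx⟩ (n + 1) (by omega)) b hb

/-- A cocommutative Hopf algebra retracts onto each of its sub-Hopf algebras `B` by a right
`B`-linear map. -/
theorem exists_retraction (hB : IsSubHopf B) :
    ∃ p : H →ₗ[k] H, (∀ x, p x ∈ B) ∧ p 1 = 1 ∧ ∀ x, ∀ b ∈ B, p (x * b) = p x * b := by
  obtain ⟨p, hp, hpB, hpmul⟩ := hB.exists_retraction_torsionPart
  let T := (Submodule.torsionPart H hB.annihilator).restrictScalars k
  let F := (Submodule.fixedPart H hB.annihilator).restrictScalars k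
  have hTF : IsCompl T F := by
    have h := CoalgebraDual.isCompl_torsionPart_fixedPart hB.annihilator
    refine ⟨Submodule.disjoint_def.2 fun x hx hy => Submodule.disjoint_def.1 h.disjoint x hx hy,
      codisjoint_iff_le_sup.2 fun x _ => ?_⟩
    obtain ⟨y, hy, z, hz, rfl⟩ := Submodule.mem_sup.1
      (show x ∈ _ ⊔ _ from h.sup_eq_top ▸ Submodule.mem_top (x := x))
    exact Submodule.add_mem_sup (show y ∈ T from hy) (show z ∈ F from hz)
  let π : H →ₗ[k] T := T.projectionOnto F hTF
  have hBT : ∀ b ∈ B, b ∈ T := fun b hb => ⟨1, hB.mem_powTorsion_one.2 hb⟩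
  have hπ : ∀ t (ht : t ∈ T) f, f ∈ F → π (t + f) = ⟨t, ht⟩ := fun t ht f hf => by
    rw [map_add, show π f = 0 from Submodule.projectionOnto_apply_of_mem_right hTF hf, add_zero]
    exact Submodule.projectionOnto_apply_left hTF ⟨t, ht⟩
  have hπT : ∀ t (ht : t ∈ T), π t = ⟨t, ht⟩ := fun t ht => by
    simpa using hπ t ht 0 F.zero_mem
  refine ⟨p ∘ₗ π, fun x => hp _, ?_, fun x b hb => ?_⟩
  · rw [LinearMap.comp_apply, hπT 1 (hBT 1 hB.one_mem), hpB _ hB.one_mem]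
  · obtain ⟨t, ht, f, hf, rfl⟩ := Submodule.mem_sup.1
      (show x ∈ T ⊔ F from hTF.sup_eq_top ▸ Submodule.mem_top)
    rw [LinearMap.comp_apply, LinearMap.comp_apply, add_mul, hπ t ht f hf,
      hπ (t * b) (hB.torsionPart_mul_mem ht hb) (f * b) (hB.fixedPart_mul_mem hf hb)]
    exact hpmul _ b hb _ _

/-- Coinvariants: if `x₁ ⊗ x₂` and `1 ⊗ x` agree modulo `I ⊗ H`, where `I` is the span of
`H · B⁺`, then `x ∈ B`. With `p` the retraction onto `B`, the map `q(a) = p(a₁) S(a₂)` kills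
`H · B⁺`, and `p(a) = q(a₁) a₂`; hence `p(x) = q(1) x = x`. -/
theorem mem_of_coinvariant (hB : IsSubHopf B) {x : H}
    (hx : (Submodule.map₂ (LinearMap.mul k H) ⊤
        (B ⊓ LinearMap.ker (counit (R := k) (A := H)))).mkQ.rTensor H (comul x) =
      (Submodule.map₂ (LinearMap.mul k H) ⊤
        (B ⊓ LinearMap.ker (counit (R := k) (A := H)))).mkQ 1 ⊗ₜ x) : x ∈ B := by
  set I := Submodule.map₂ (LinearMap.mul k H) ⊤ (B ⊓ LinearMap.ker (counit (R := k) (A := H)))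
    with hI
  obtain ⟨p, hp, hp1, hpB⟩ := hB.exists_retraction
  let q : WithConv (H →ₗ[k] H) :=
    WithConv.toConv p * WithConv.toConv (HopfAlgebra.antipode k (A := H))
  have hqp : q * WithConv.toConv LinearMap.id = WithConv.toConv p := by
    rw [mul_assoc, LinearMap.antipode_mul_id, mul_one]
  have hq : ∀ a, ∀ b ∈ B, q (a * b) = counit (R := k) b • q a := by
    intro a b hb
    obtain ⟨r, hr⟩ := hB.exists_repr hb
    rw [((ℛ k a).mul r).convMul_apply, (ℛ k a).convMul_apply, Finset.smul_sum,
      Coalgebra.Repr.mul_index, Finset.sum_product]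
    refine Finset.sum_congr rfl fun i _ => ?_
    calc _ = p ((ℛ k a).left i) * (∑ j ∈ r.index, r.left j *
          HopfAlgebra.antipode k (r.right j)) * HopfAlgebra.antipode k ((ℛ k a).right i) := by
          rw [Finset.mul_sum, Finset.sum_mul]
          refine Finset.sum_congr rfl fun j _ => ?_
          simp [hpB _ _ (hr j).1, HopfAlgebra.antipode_mul_antidistrib, mul_assoc]
      _ = _ := by
          rw [HopfAlgebra.sum_mul_antipode_eq_smul]
          simp
  have hqI : I ≤ LinearMap.ker q.ofConv := by
    rw [hI, Submodule.map₂_le]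
    rintro a - b ⟨hb, hbε⟩
    rw [LinearMap.mem_ker]
    change q (a * b) = 0
    rw [hq a b hb, LinearMap.mem_ker.1 hbε, zero_smul]
  have h1 : ∀ t : H ⊗[k] H, LinearMap.mul' k H (TensorProduct.map q.ofConv LinearMap.id t) =
      LinearMap.mul' k H (TensorProduct.map (I.liftQ q.ofConv hqI) LinearMap.id
        (I.mkQ.rTensor H t)) := by
    intro t
    induction t with
    | zero => simp
    | add s t hs ht => simp only [map_add, hs, ht]
    | tmul a b => simp
  have h2 : p x = (q * WithConv.toConv LinearMap.id : WithConv (H →ₗ[k] H)) x := by rw [hqp]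
  have h3 : q.ofConv 1 = 1 := by
    change LinearMap.mul' k H (TensorProduct.map p (HopfAlgebra.antipode k) (comul (R := k) 1)) = 1
    simp [Algebra.TensorProduct.one_def, hp1]
  rw [LinearMap.convMul_apply, WithConv.ofConv_toConv, h1, hx] at h2
  have h4 : p x = x := by
    rw [h2]
    simp [h3]
  exact h4 ▸ hp x

end IsSubHopf

/-! ### The second Hopf algebra of a Hopf brace -/

namespace HopfBrace

/-- The Hopf algebra `A^•`: a copy of the vector space `A` with product `•` and antipode `T`. -/
def CircAlg (_k : Type u) (A : Type v) : Type v := A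

namespace CircAlg

variable {k : Type u} {A : Type v} [Field k] [Ring A] [HopfBrace k A]

noncomputable instance : AddCommGroup (CircAlg k A) := inferInstanceAs (AddCommGroup A)

noncomputable instance : Module k (CircAlg k A) := inferInstanceAs (Module k A)

noncomputable instance : Coalgebra k (CircAlg k A) := inferInstanceAs (Coalgebra k A)

instance [IsCocomm k A] : IsCocomm k (CircAlg k A) := inferInstanceAs (IsCocomm k A)

noncomputable instance : Ring (CircAlg k A) where
  __ := (inferInstance : AddCommGroup (CircAlg k A))
  mul a b := (circ (k := k) (H := A) a b : A)
  one := (1 : A)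
  mul_assoc := circ_assoc (k := k) (H := A)
  one_mul := one_circ (k := k) (H := A)
  mul_one := circ_one (k := k) (H := A)
  left_distrib a b c := map_add (circ (k := k) (H := A) a) b c
  right_distrib a b c := LinearMap.map_add₂ (circ (k := k) (H := A)) a b c
  zero_mul a := LinearMap.map_zero₂ (circ (k := k) (H := A)) a
  mul_zero a := map_zero (circ (k := k) (H := A) a)

noncomputable instance : Algebra k (CircAlg k A) :=
  Algebra.ofModule
    (fun r a b => LinearMap.map_smul₂ (circ (k := k) (H := A)) r a b)
    (fun r a b => map_smul (circ (k := k) (H := A) a) r b)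

noncomputable instance : Bialgebra k (CircAlg k A) :=
  Bialgebra.mk' k (CircAlg k A)
    (Bialgebra.counit_one (R := k) (A := A))
    (fun {a b} => counit_circ (k := k) (H := A) a b)
    (Bialgebra.comul_one (R := k) (A := A))
    (fun {a b} => by
      have h : ∀ s t : CircAlg k A ⊗[k] CircAlg k A, s * t =
          TensorProduct.map₂ (LinearMap.mul k (CircAlg k A))
            (LinearMap.mul k (CircAlg k A)) s t := by
        intro s t
        induction s with
        | zero => rw [zero_mul, LinearMap.map_zero₂]
        | add s s' hs hs' => rw [add_mul, hs, hs', LinearMap.map_add₂]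
        | tmul a b =>
          induction t with
          | zero => rw [mul_zero, map_zero]
          | add t t' ht ht' => rw [mul_add, ht, ht', map_add]
          | tmul c d => simp
      exact (comul_circ (k := k) (H := A) a b).trans (h _ _).symm)

noncomputable instance : HopfAlgebra k (CircAlg k A) where
  antipode := circAntipode (k := k) (H := A)
  mul_antipode_rTensor_comul := LinearMap.ext fun a =>
    (circAntipode_circ (k := k) (H := A) a).trans
      (Algebra.algebraMap_eq_smul_one (A := CircAlg k A) _).symm
  mul_antipode_lTensor_comul := LinearMap.ext fun a =>
    (circ_circAntipode (k := k) (H := A) a).trans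
      (Algebra.algebraMap_eq_smul_one (A := CircAlg k A) _).symm

end CircAlg

end HopfBrace

/-! ### Antipode, adjoint action and kernels in cocommutative Hopf algebras -/

namespace CocommHopf

open WithConv

section Basic

variable {k H : Type*} [Field k] [Ring H] [HopfAlgebra k H]

local notation "S" => HopfAlgebra.antipode k (A := H)

/-- The adjoint action `a₁ b S(a₂)`. -/
noncomputable def adj (k : Type*) {H : Type*} [Field k] [Ring H] [HopfAlgebra k H] (a b : H) : H :=
  LinearMap.mul' k H
    (TensorProduct.map (LinearMap.mulRight k b) (HopfAlgebra.antipode k) (comul (R := k) a))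

theorem adj_eq_sum {ι : Type*} {a : H} (r : Repr k a ι) (b : H) :
    adj k a b = ∑ i ∈ r.index, r.left i * b * S (r.right i) := by
  simp [adj, ← r.eq]

theorem mul_mem_left {P : Submodule k H} {x : H}
    (hx : x ∈ Submodule.map₂ (LinearMap.mul k H) ⊤ P) (c : H) :
    c * x ∈ Submodule.map₂ (LinearMap.mul k H) ⊤ P := by
  suffices h : Submodule.map₂ (LinearMap.mul k H) ⊤ P ≤
      (Submodule.map₂ (LinearMap.mul k H) ⊤ P).comap (LinearMap.mulLeft k c) from h hx
  rw [Submodule.map₂_le]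
  intro a _ b hb
  change c * (a * b) ∈ Submodule.map₂ (LinearMap.mul k H) ⊤ P
  rw [← mul_assoc]
  exact Submodule.apply_mem_map₂ (LinearMap.mul k H) trivial hb

variable [IsCocomm k H]

/-- For cocommutative `H` the antipode commutes with `Δ`: both sides are convolution inverses of
`Δ : H → H ⊗ H`. -/
theorem comul_comp_antipode :
    (comul (R := k)) ∘ₗ S = TensorProduct.map (S) (S) ∘ₗ comul := by
  apply toConv_injective
  refine (left_inv_eq_right_inv (a := toConv (comul (R := k) (A := H))) ?_
    LinearMap.comul_right_inv).symm
  have h := LinearMap.convMul_comp_coalgHom_distrib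
    (toConv (TensorProduct.map (S) (S))) (toConv (TensorProduct.map LinearMap.id LinearMap.id))
    (Coalgebra.comulCoalgHom k H)
  have h' := TensorProduct.map_convMul_map (f := toConv (S)) (g := toConv (S))
    (h := toConv (LinearMap.id : H →ₗ[k] H)) (k := toConv (LinearMap.id : H →ₗ[k] H))
  simp only [LinearMap.antipode_mul_id] at h h'
  rw [h'] at h
  rw [TensorProduct.map_id, LinearMap.id_comp] at h
  apply ofConv_injective
  refine Eq.trans h.symm ?_
  ext x
  have hx : ∑ i ∈ (ℛ k x).index, counit (R := k) ((ℛ k x).right i) *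
      counit (R := k) ((ℛ k x).left i) = counit (R := k) x := by
    have := congrArg (counit (R := k)) (Coalgebra.sum_counit_smul (ℛ k x))
    simpa [mul_comm] using this
  change TensorProduct.map _ _ (comul (R := k) x) = algebraMap k (H ⊗[k] H) (counit (R := k) x)
  rw [← hx, ← (ℛ k x).eq, map_sum, map_sum]
  refine Finset.sum_congr rfl fun i _ => ?_
  simp [Algebra.algebraMap_eq_smul_one, TensorProduct.smul_tmul', TensorProduct.tmul_smul, mul_smul,
    Algebra.TensorProduct.one_def]

/-- The antipode of a cocommutative Hopf algebra as a coalgebra morphism. -/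
noncomputable def antipodeHom (k H : Type*) [Field k] [Ring H] [HopfAlgebra k H] [IsCocomm k H] :
    H →ₗc[k] H where
  toLinearMap := HopfAlgebra.antipode k
  counit_comp := HopfAlgebra.counit_comp_antipode
  map_comp_comul := comul_comp_antipode.symm

/-- `S ∘ S` and the identity are both convolution inverses of `S`. -/
theorem antipode_antipode (x : H) : S (S x) = x := by
  have h : (toConv ((S) ∘ₗ (S)) : WithConv (H →ₗ[k] H)) = toConv LinearMap.id := by
    refine (left_inv_eq_right_inv (a := toConv (S)) LinearMap.id_mul_antipode ?_).symm
    have := LinearMap.convMul_comp_coalgHom_distrib (toConv LinearMap.id) (toConv (S))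
      (antipodeHom k H)
    rw [LinearMap.id_mul_antipode] at this
    apply ofConv_injective
    refine Eq.trans this.symm ?_
    ext y
    simp [antipodeHom]
  exact LinearMap.congr_fun (toConv_injective h) x

/-- `b c = c₁ · (S(c₂) ▷ b)`, where `▷` is the adjoint action. -/
theorem mul_eq_sum_adj (b c : H) :
    b * c = ∑ i ∈ (ℛ k c).index, (ℛ k c).left i * adj k (S ((ℛ k c).right i)) b := by
  have h : ∀ x, adj k (S x) b = (toConv (S) * toConv (LinearMap.mulLeft k b) :
      WithConv (H →ₗ[k] H)) x := by
    intro x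
    rw [(ℛ k x).convMul_apply]
    refine (adj_eq_sum ((ℛ k x).induced (antipodeHom k H)) b).trans ?_
    refine Finset.sum_congr rfl fun i _ => ?_
    change S _ * b * S (S _) = _
    rw [antipode_antipode, mul_assoc]
    rfl
  simp only [h]
  have h2 : (toConv LinearMap.id * (toConv (S) * toConv (LinearMap.mulLeft k b)) :
      WithConv (H →ₗ[k] H)) = toConv (LinearMap.mulLeft k b) := by
    rw [← mul_assoc, LinearMap.id_mul_antipode, one_mul]
  have h3 := (ℛ k c).convMul_apply (toConv LinearMap.id)
    (toConv (S) * toConv (LinearMap.mulLeft k b))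
  rw [h2] at h3
  exact h3

theorem mul_mem_right {P : Submodule k H} (hP : ∀ a, ∀ b ∈ P, adj k a b ∈ P) {x : H}
    (hx : x ∈ Submodule.map₂ (LinearMap.mul k H) ⊤ P) (c : H) :
    x * c ∈ Submodule.map₂ (LinearMap.mul k H) ⊤ P := by
  suffices h : Submodule.map₂ (LinearMap.mul k H) ⊤ P ≤
      (Submodule.map₂ (LinearMap.mul k H) ⊤ P).comap (LinearMap.mulRight k c) from h hx
  rw [Submodule.map₂_le]
  intro a _ b hb
  change a * b * c ∈ Submodule.map₂ (LinearMap.mul k H) ⊤ P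
  rw [mul_assoc, mul_eq_sum_adj (k := k) b c, Finset.mul_sum]
  refine Submodule.sum_mem _ fun i _ => ?_
  rw [← mul_assoc]
  exact Submodule.apply_mem_map₂ (LinearMap.mul k H) trivial (hP _ _ hb)

theorem antipode_mem {P : Submodule k H} (hP : ∀ a, ∀ b ∈ P, adj k a b ∈ P)
    (hPS : ∀ b ∈ P, S b ∈ P) {x : H} (hx : x ∈ Submodule.map₂ (LinearMap.mul k H) ⊤ P) :
    S x ∈ Submodule.map₂ (LinearMap.mul k H) ⊤ P := by
  suffices h : Submodule.map₂ (LinearMap.mul k H) ⊤ P ≤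
      (Submodule.map₂ (LinearMap.mul k H) ⊤ P).comap (S) from h hx
  rw [Submodule.map₂_le]
  intro a _ b hb
  change S (a * b) ∈ Submodule.map₂ (LinearMap.mul k H) ⊤ P
  rw [HopfAlgebra.antipode_mul_antidistrib]
  refine mul_mem_right hP ?_ _
  rw [← one_mul (S b)]
  exact Submodule.apply_mem_map₂ (LinearMap.mul k H) trivial (hPS b hb)

end Basic

end CocommHopf

namespace CocommHopf

open WithConv

section Points

variable {k C H : Type*} [Field k] [AddCommGroup C] [Module k C] [Coalgebra k C] [IsCocomm k C]
  [Ring H] [HopfAlgebra k H]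

/-- The convolution product of coalgebra morphisms out of a cocommutative coalgebra. -/
noncomputable def convHom (u v : C →ₗc[k] H) : C →ₗc[k] H :=
  (Bialgebra.mulCoalgHom k H).comp
    ((Coalgebra.TensorProduct.map u v).comp (Coalgebra.comulCoalgHom k C))

theorem convHom_eq_sum {ι : Type*} (u v : C →ₗc[k] H) {c : C} (r : Repr k c ι) :
    convHom u v c = ∑ i ∈ r.index, u (r.left i) * v (r.right i) := by
  change LinearMap.mul' k H (TensorProduct.map u.toLinearMap v.toLinearMap (comul (R := k) c)) = _
  simp [← r.eq]

/-- The projection `a ⊗ b ↦ ε(b) a`. -/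
noncomputable def fstHom (k H : Type*) [Field k] [Ring H] [HopfAlgebra k H] :
    H ⊗[k] H →ₗc[k] H :=
  (Coalgebra.TensorProduct.rid k k H).toCoalgHom.comp
    (Coalgebra.TensorProduct.map (CoalgHom.id k H) (Coalgebra.counitCoalgHom k H))

theorem fstHom_tmul (a b : H) : fstHom k H (a ⊗ₜ b) = counit (R := k) b • a := by
  change Coalgebra.TensorProduct.rid k k H (Coalgebra.TensorProduct.map (CoalgHom.id k H)
    (Coalgebra.counitCoalgHom k H) (a ⊗ₜ b)) = _
  simp

end Points

section Adjoint

variable {k H : Type*} [Field k] [Ring H] [HopfAlgebra k H]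

theorem sum_counit_right_smul {ι : Type*} {b : H} (r : Repr k b ι) :
    ∑ i ∈ r.index, counit (R := k) (r.right i) • r.left i = b := by
  rw [← dualAction_eq_sum r, dualAction_counit]

variable [IsCocomm k H]

/-- The adjoint action as a coalgebra morphism. -/
noncomputable def adjHom (k H : Type*) [Field k] [Ring H] [HopfAlgebra k H] [IsCocomm k H] :
    H ⊗[k] H →ₗc[k] H :=
  convHom (Bialgebra.mulCoalgHom k H) ((antipodeHom k H).comp (fstHom k H))

theorem adjHom_tmul (a b : H) : adjHom k H (a ⊗ₜ b) = adj k a b := by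
  rw [adjHom, convHom_eq_sum _ _ ((ℛ k a).tmul (ℛ k b)), adj_eq_sum (ℛ k a),
    Coalgebra.Repr.tmul_index, Finset.sum_product]
  refine Finset.sum_congr rfl fun i _ => ?_
  conv_rhs => rw [← sum_counit_right_smul (ℛ k b), Finset.mul_sum, Finset.sum_mul]
  refine Finset.sum_congr rfl fun j _ => ?_
  rw [CoalgHom.coe_comp, Function.comp_apply, Coalgebra.Repr.tmul_right, Coalgebra.Repr.tmul_left,
    fstHom_tmul, map_smul]
  change (ℛ k a).left i * (ℛ k b).left j * (_ • HopfAlgebra.antipode k _) = _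
  simp

theorem counit_adj (a b : H) :
    counit (R := k) (adj k a b) = counit (R := k) a * counit (R := k) b := by
  rw [← adjHom_tmul, CoalgHomClass.counit_comp_apply]
  simp [mul_comm]

end Adjoint

section Kernel

variable {k H K : Type*} [Field k] [Ring H] [HopfAlgebra k H] [Ring K] [HopfAlgebra k K]

local notation "S" => HopfAlgebra.antipode k

/-- The kernel `{a | f(a₁) ⊗ a₂ = 1 ⊗ a}` of a morphism of Hopf algebras. -/
noncomputable def lker (f : H →ₐc[k] K) : Subalgebra k H :=
  AlgHom.equalizer
    ((Algebra.TensorProduct.map (f : H →ₐ[k] K) (AlgHom.id k H)).comp (Bialgebra.comulAlgHom k H))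
    (Algebra.TensorProduct.includeRight : H →ₐ[k] K ⊗[k] H)

theorem mem_lker {f : H →ₐc[k] K} {a : H} :
    a ∈ lker f ↔ (f : H →ₗ[k] K).rTensor H (comul (R := k) a) = 1 ⊗ₜ a := Iff.rfl

theorem apply_of_mem_lker {f : H →ₐc[k] K} {a : H} (ha : a ∈ lker f) :
    f a = algebraMap k K (counit (R := k) a) := by
  have h := congrArg (fun t => TensorProduct.rid k K ((counit (R := k)).lTensor K t))
    (mem_lker.1 ha)
  have h2 : ∀ t : H ⊗[k] H, TensorProduct.rid k K ((counit (R := k)).lTensor K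
      ((f : H →ₗ[k] K).rTensor H t)) =
      f (TensorProduct.rid k H ((counit (R := k)).lTensor H t)) := by
    intro t
    induction t with
    | zero => simp
    | add s t hs ht => simp only [map_add, hs, ht]
    | tmul a b => simp
  rw [h2] at h
  simpa [Algebra.algebraMap_eq_smul_one] using h

/-- If a coalgebra morphism `m : H ⊗ H → H` becomes trivial on `a ⊗ b`, for all `b` in a
subcoalgebra `B`, after composition with `f`, then `m (a ⊗ b)` lies in the kernel of `f`. -/
theorem mem_lker_of_trivial {f : H →ₐc[k] K} (m : H ⊗[k] H →ₗc[k] H) {B : Submodule k H}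
    (hm : ∀ a, ∀ b ∈ B, f (m (a ⊗ₜ b)) = (counit (R := k) a * counit (R := k) b) • 1)
    (a : H) {b : H}
    (hb : comul (R := k) b ∈ LinearMap.range (TensorProduct.map B.subtype B.subtype)) :
    m (a ⊗ₜ b) ∈ lker f := by
  obtain ⟨r, hr⟩ := exists_repr_of_mem_range hb
  rw [mem_lker, ← (((ℛ k a).tmul r).induced m).eq, map_sum]
  have h : a ⊗ₜ[k] b = ∑ i ∈ ((ℛ k a).tmul r).index,
      (counit (R := k) ((ℛ k a).left i.1) * counit (R := k) (r.left i.2)) •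
        ((ℛ k a).tmul r).right i := by
    conv_lhs => rw [← Coalgebra.sum_counit_smul (ℛ k a), ← Coalgebra.sum_counit_smul r]
    rw [TensorProduct.sum_tmul, Coalgebra.Repr.tmul_index, Finset.sum_product]
    refine Finset.sum_congr rfl fun i _ => ?_
    rw [TensorProduct.tmul_sum]
    refine Finset.sum_congr rfl fun j _ => ?_
    simp [TensorProduct.smul_tmul', mul_smul, TensorProduct.tmul_smul]
    rw [smul_comm]
  conv_rhs => rw [h, map_sum, TensorProduct.tmul_sum]
  refine Finset.sum_congr rfl fun i _ => ?_
  rw [LinearMap.rTensor_tmul]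
  change f (m ((ℛ k a).left i.1 ⊗ₜ r.left i.2)) ⊗ₜ m _ = _
  rw [hm _ _ (hr i.2).1, map_smul, TensorProduct.smul_tmul]

theorem map_antipode (f : H →ₐc[k] K) (a : H) : f (S a) = S (f a) := by
  have h : toConv ((f : H →ₗ[k] K) ∘ₗ S) = toConv ((S) ∘ₗ (f : H →ₗ[k] K)) := by
    refine left_inv_eq_right_inv (a := toConv (f : H →ₗ[k] K)) ?_ ?_
    · have := LinearMap.algHom_comp_convMul_distrib (f : H →ₐ[k] K) (toConv (S : H →ₗ[k] H))
        (toConv LinearMap.id)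
      rw [LinearMap.antipode_mul_id] at this
      apply ofConv_injective
      refine Eq.trans this.symm ?_
      ext x
      exact AlgHomClass.commutes f (counit (R := k) x)
    · have := LinearMap.convMul_comp_coalgHom_distrib (toConv LinearMap.id)
        (toConv (S : K →ₗ[k] K)) (f : H →ₗc[k] K)
      rw [LinearMap.id_mul_antipode] at this
      apply ofConv_injective
      refine Eq.trans this.symm ?_
      ext x
      simp
  exact LinearMap.congr_fun (toConv_injective h) a

theorem map_adj (f : H →ₐc[k] K) (a b : H) : f (adj k a b) = adj k (f a) (f b) := by
  refine Eq.trans ?_ (adj_eq_sum ((ℛ k a).induced (f : H →ₗc[k] K)) (f b)).symm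
  rw [adj_eq_sum (ℛ k a), map_sum]
  refine Finset.sum_congr rfl fun i _ => ?_
  rw [map_mul, map_mul, map_antipode]
  rfl

theorem map_adj_of_trivial (f : H →ₐc[k] K) (a : H) {b : H}
    (hb : f b = algebraMap k K (counit (R := k) b)) :
    f (adj k a b) = (counit (R := k) a * counit (R := k) b) • 1 := by
  rw [map_adj, hb, adj_eq_sum (ℛ k (f a))]
  have h : ∀ x y : K, x * algebraMap k K (counit (R := k) b) * y = counit (R := k) b • (x * y) := by
    intro x y
    simp [Algebra.algebraMap_eq_smul_one]
  simp only [h]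
  rw [← Finset.smul_sum, HopfAlgebra.sum_mul_antipode_eq_smul, smul_smul,
    CoalgHomClass.counit_comp_apply, mul_comm]

variable [IsCocomm k H]

theorem antipode_mem_lker {f : H →ₐc[k] K} {a : H} (ha : a ∈ lker f) : S a ∈ lker f := by
  rw [mem_lker] at ha ⊢
  have h1 : comul (R := k) (S a) = TensorProduct.map (S) (S) (comul (R := k) a) :=
    LinearMap.congr_fun comul_comp_antipode a
  have h2 : ∀ t : H ⊗[k] H, (f : H →ₗ[k] K).rTensor H (TensorProduct.map (S) (S) t) =
      TensorProduct.map (S) (S) ((f : H →ₗ[k] K).rTensor H t) := by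
    intro t
    induction t with
    | zero => simp
    | add s t hs ht => simp only [map_add, hs, ht]
    | tmul a b => simp [map_antipode]
  rw [h1, h2, ha]
  simp

/-- If `f` is trivial on the subcoalgebra `B`, then `a ▷ b` lies in the kernel of `f` for all
`b ∈ B`. -/
theorem adj_mem_lker {f : H →ₐc[k] K} {B : Submodule k H}
    (hf : ∀ b ∈ B, f b = algebraMap k K (counit (R := k) b)) (a : H) {b : H}
    (hb : comul (R := k) b ∈ LinearMap.range (TensorProduct.map B.subtype B.subtype)) :
    adj k a b ∈ lker f := by
  rw [← adjHom_tmul]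
  refine mem_lker_of_trivial (adjHom k H) (fun a b hb => ?_) a hb
  rw [adjHom_tmul]
  exact map_adj_of_trivial f a (hf b hb)

/-- The kernel is a left coideal, since it is the kernel of the right `H`-comodule map
`a ↦ f(a₁) ⊗ a₂ - 1 ⊗ a`; hence it is a subcoalgebra by cocommutativity. -/
theorem comul_mem_lker {f : H →ₐc[k] K} {a : H} (ha : a ∈ lker f) :
    comul (R := k) a ∈ LinearMap.range (TensorProduct.map
      (Subalgebra.toSubmodule (lker f)).subtype (Subalgebra.toSubmodule (lker f)).subtype) := by
  apply comul_mem_map_of_mem_rTensor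
  let φ : H →ₗ[k] K ⊗[k] H := (f : H →ₗ[k] K).rTensor H ∘ₗ comul
  let ψ : H →ₗ[k] K ⊗[k] H := TensorProduct.mk k K H 1
  have hker : Subalgebra.toSubmodule (lker f) = LinearMap.ker (φ - ψ) := by
    ext x
    rw [LinearMap.mem_ker, LinearMap.sub_apply, sub_eq_zero]
    rfl
  rw [hker]
  have hex := Module.Flat.rTensor_exact H (LinearMap.exact_subtype_ker_map (φ - ψ))
  refine (hex _).1 ?_
  rw [LinearMap.rTensor_sub, LinearMap.sub_apply, sub_eq_zero]
  have h1 : ∀ t : H ⊗[k] (H ⊗[k] H), ((f : H →ₗ[k] K).rTensor H).rTensor H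
      ((TensorProduct.assoc k H H H).symm t) =
      (TensorProduct.assoc k K H H).symm ((f : H →ₗ[k] K).rTensor (H ⊗[k] H) t) := by
    intro t
    induction t with
    | zero => simp
    | add s t hs ht => simp only [map_add, hs, ht]
    | tmul x t =>
      induction t with
      | zero => simp
      | add s t hs ht => simp only [tmul_add, map_add, hs, ht]
      | tmul y z => simp
  calc φ.rTensor H (comul (R := k) a)
      = ((f : H →ₗ[k] K).rTensor H).rTensor H ((comul (R := k)).rTensor H (comul (R := k) a)) := by
        rw [LinearMap.rTensor_comp_apply]
    _ = (TensorProduct.assoc k K H H).symm ((f : H →ₗ[k] K).rTensor (H ⊗[k] H)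
          ((comul (R := k)).lTensor H (comul (R := k) a))) := by
        rw [← Coalgebra.coassoc_symm_apply, h1]
    _ = (TensorProduct.assoc k K H H).symm ((comul (R := k)).lTensor K
          ((f : H →ₗ[k] K).rTensor H (comul (R := k) a))) := by
        rw [← LinearMap.comp_apply (LinearMap.rTensor _ _), LinearMap.rTensor_comp_lTensor,
          ← LinearMap.lTensor_comp_rTensor, LinearMap.comp_apply]
    _ = ψ.rTensor H (comul (R := k) a) := by
        rw [mem_lker.1 ha, LinearMap.lTensor_tmul, ← (ℛ k a).eq]
        simp [TensorProduct.tmul_sum, ψ]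

end Kernel

end CocommHopf

open CocommHopf

/-! ### The left action of a Hopf brace -/

namespace IsSubHopf

variable {k H : Type*} [Field k] [Ring H] [HopfAlgebra k H] {B : Submodule k H}

theorem isCoideal_mul_plus (hB : IsSubHopf B) : (Submodule.map₂ (LinearMap.mul k H) ⊤
    (B ⊓ LinearMap.ker (counit (R := k) (A := H)))).IsCoideal := by
  set I := Submodule.map₂ (LinearMap.mul k H) ⊤ (B ⊓ LinearMap.ker (counit (R := k) (A := H)))
    with hI
  have hmk : ∀ a, ∀ b ∈ B, I.mkQ (a * b) = counit (R := k) b • I.mkQ a := fun a b hb => by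
    rw [← map_smul, ← sub_eq_zero, ← map_sub, Submodule.mkQ_apply, Submodule.Quotient.mk_eq_zero,
      show a * b - counit (R := k) b • a = a * (b - counit (R := k) b • 1) by simp [mul_sub]]
    refine Submodule.apply_mem_map₂ (LinearMap.mul k H) trivial
      ⟨B.sub_mem hb (B.smul_mem _ hB.one_mem), ?_⟩
    simp
  constructor
  · suffices h : I ≤ LinearMap.ker (counit (R := k) (A := H)) from fun x hx => h hx
    rw [hI, Submodule.map₂_le]
    rintro a - b ⟨-, hb⟩
    have hb' : counit (R := k) b = 0 := hb
    simp [hb']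
  · suffices h : I ≤ LinearMap.ker (TensorProduct.map I.mkQ I.mkQ ∘ₗ comul (R := k)) from
      fun x hx => h hx
    conv_lhs => rw [hI]
    rw [Submodule.map₂_le]
    rintro a - b ⟨hb, hbε⟩
    obtain ⟨r, hr⟩ := hB.exists_repr hb
    replace hbε : counit (R := k) b = 0 := hbε
    rw [LinearMap.mem_ker, LinearMap.comp_apply, LinearMap.mul_apply', ← ((ℛ k a).mul r).eq, map_sum,
      Coalgebra.Repr.mul_index, Finset.sum_product]
    refine Finset.sum_eq_zero fun i _ => ?_
    have h0 : ∑ j ∈ r.index, counit (R := k) (r.left j) * counit (R := k) (r.right j) = 0 := by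
      have := congrArg (counit (R := k)) (Coalgebra.sum_counit_smul r)
      rw [hbε, map_sum] at this
      simpa using this
    calc _ = ∑ j ∈ r.index, (counit (R := k) (r.left j) * counit (R := k) (r.right j)) •
          (I.mkQ ((ℛ k a).left i) ⊗ₜ[k] I.mkQ ((ℛ k a).right i)) := by
          refine Finset.sum_congr rfl fun j _ => ?_
          rw [TensorProduct.map_tmul, Coalgebra.Repr.mul_left, Coalgebra.Repr.mul_right,
            hmk _ _ (hr j).1, hmk _ _ (hr j).2, TensorProduct.smul_tmul_smul]
      _ = 0 := by rw [← Finset.sum_smul, h0, zero_smul]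

end IsSubHopf

namespace HopfBrace

open WithConv

variable {k : Type u} {A : Type v} [Field k] [Ring A] [HopfBrace k A]

local notation "S" => HopfAlgebra.antipode k (A := A)
local notation "T" => circAntipode (k := k) (H := A)

theorem leftAction_eq_sum {ι : Type*} {a : A} (r : Repr k a ι) (b : A) :
    leftAction k a b = ∑ i ∈ r.index, S (r.left i) * circ (k := k) (r.right i) b := by
  simp [leftAction, ← r.eq]

/-- `a • b = a₁ · (a₂ ⇀ b)`. -/
theorem circ_eq_sum (a b : A) : circ (k := k) a b =
    ∑ i ∈ (ℛ k a).index, (ℛ k a).left i * leftAction k ((ℛ k a).right i) b := by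
  have h := (ℛ k a).convMul_apply (toConv LinearMap.id)
    (toConv (S) * toConv ((circ (k := k) (H := A)).flip b))
  rw [← mul_assoc, LinearMap.id_mul_antipode, one_mul] at h
  exact h

/-- `a • (y b) = (a₁ • y) · (a₂ ⇀ b)`. -/
theorem circ_mul_eq_sum {ι : Type*} {a : A} (r : Repr k a ι) (y b : A) : circ (k := k) a (y * b) =
    ∑ i ∈ r.index, circ (k := k) (r.left i) y * leftAction k (r.right i) b := by
  rw [circ_mul, ← r.eq, map_sum, map_sum, map_sum]
  rfl

/-- The left action as a linear map in its first variable. -/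
noncomputable def leftActionₗ (k : Type u) {A : Type v} [Field k] [Ring A] [HopfBrace k A] (b : A) :
    A →ₗ[k] A :=
  LinearMap.mul' k A ∘ₗ
    TensorProduct.map (HopfAlgebra.antipode k) ((circ (k := k)).flip b) ∘ₗ comul (R := k)

variable [IsCocomm k A]

theorem comul_circAntipode (a : A) :
    comul (R := k) (T a) = TensorProduct.map (T) (T) (comul (R := k) a) :=
  LinearMap.congr_fun (comul_comp_antipode (k := k) (H := CircAlg k A)) a

/-- `T(a₁) • (a₂ b) = T(a) ⇀ b`. -/
theorem leftAction_circAntipode_eq_sum (a b : A) : leftAction k (T a) b =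
    ∑ i ∈ (ℛ k a).index, circ (k := k) (T ((ℛ k a).left i)) ((ℛ k a).right i * b) := by
  let ψ : A ⊗[k] A →ₗ[k] A := TensorProduct.lift (circ (k := k) ∘ₗ T)
  let l : A →ₗ[k] A := leftActionₗ k b ∘ₗ T
  let Ψ : A ⊗[k] A →ₗ[k] A :=
    TensorProduct.lift ((LinearMap.lcomp k A (LinearMap.mulRight k b)) ∘ₗ circ (k := k) ∘ₗ T)
  let Θ : A ⊗[k] A ⊗[k] A →ₗ[k] A := LinearMap.mul' k A ∘ₗ
    TensorProduct.map (ψ ∘ₗ (TensorProduct.comm k A A).toLinearMap) l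
  -- the compatibility axiom, applied to `T x`
  have hΨ : ∀ t : A ⊗[k] A, Ψ ((TensorProduct.comm k A A) t) =
      Θ ((TensorProduct.assoc k A A A).symm ((comul (R := k)).lTensor A t)) := by
    intro t
    induction t with
    | zero => simp
    | add s t hs ht => simp only [map_add, hs, ht]
    | tmul y x =>
      let r : Repr k (T x) (A × A) := ⟨(ℛ k x).index, fun i => T ((ℛ k x).left i),
        fun i => T ((ℛ k x).right i), by
          rw [comul_circAntipode, ← (ℛ k x).eq, map_sum]; rfl⟩
      change circ (k := k) (T x) (y * b) = _
      rw [circ_mul_eq_sum r, LinearMap.lTensor_tmul, ← (ℛ k x).eq, TensorProduct.tmul_sum,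
        map_sum, map_sum]
      rfl
  have hψ : ∀ x : A, (ψ ∘ₗ (TensorProduct.comm k A A).toLinearMap) (comul (R := k) x) =
      counit (R := k) x • 1 := by
    intro x
    rw [LinearMap.comp_apply, LinearEquiv.coe_coe, Coalgebra.comm_comul]
    rw [← circAntipode_circ (k := k) x, ← (ℛ k x).eq, map_sum, map_sum, map_sum]
    rfl
  have hΘ : ∀ t : A ⊗[k] A, Θ ((comul (R := k)).rTensor A t) =
      l (TensorProduct.lid k A ((counit (R := k)).rTensor A t)) := by
    intro t
    induction t with
    | zero => simp
    | add s t hs ht => simp only [map_add, hs, ht]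
    | tmul x z =>
      rw [LinearMap.rTensor_tmul, LinearMap.comp_apply, TensorProduct.map_tmul, hψ]
      simp
  have h := hΨ (comul (R := k) a)
  rw [Coalgebra.comm_comul, Coalgebra.coassoc_symm_apply, hΘ, Coalgebra.rTensor_counit_comul,
    TensorProduct.lid_tmul, one_smul] at h
  refine Eq.trans h.symm ?_
  rw [← (ℛ k a).eq, map_sum]
  rfl

/-- `a b = a₁ • (T(a₂) ⇀ b)`. -/
theorem mul_eq_sum_circ (a b : A) : a * b = ∑ i ∈ (ℛ k a).index,
    circ (k := k) ((ℛ k a).left i) (leftAction k (T ((ℛ k a).right i)) b) := by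
  let R : CircAlg k A →ₗ[k] CircAlg k A := (LinearMap.mulRight k b : A →ₗ[k] A)
  have h := (ℛ k (A := CircAlg k A) a).convMul_apply (toConv LinearMap.id)
    (toConv (HopfAlgebra.antipode k (A := CircAlg k A)) * toConv R)
  rw [← mul_assoc, LinearMap.id_mul_antipode, one_mul] at h
  refine h.trans (Finset.sum_congr rfl fun i _ => ?_)
  rw [leftAction_circAntipode_eq_sum]
  congr 1
  exact (ℛ k (A := CircAlg k A) ((ℛ k a).right i)).convMul_apply
    (toConv (HopfAlgebra.antipode k (A := CircAlg k A))) (toConv R)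

/-- The product `•` as a coalgebra morphism. -/
noncomputable def circHom (k : Type u) (A : Type v) [Field k] [Ring A] [HopfBrace k A] :
    A ⊗[k] A →ₗc[k] A :=
  Bialgebra.mulCoalgHom k (CircAlg k A)

/-- The left action as a coalgebra morphism. -/
noncomputable def leftActionHom (k : Type u) (A : Type v) [Field k] [Ring A] [HopfBrace k A]
    [IsCocomm k A] : A ⊗[k] A →ₗc[k] A :=
  convHom ((antipodeHom k A).comp (fstHom k A)) (circHom k A)

theorem leftActionHom_tmul (a b : A) : leftActionHom k A (a ⊗ₜ b) = leftAction k a b := by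
  rw [leftActionHom, convHom_eq_sum _ _ ((ℛ k a).tmul (ℛ k b)), leftAction_eq_sum (ℛ k a),
    Coalgebra.Repr.tmul_index, Finset.sum_product]
  refine Finset.sum_congr rfl fun i _ => ?_
  conv_rhs => rw [← Coalgebra.sum_counit_smul (ℛ k b), map_sum, Finset.mul_sum]
  refine Finset.sum_congr rfl fun j _ => ?_
  rw [CoalgHom.coe_comp, Function.comp_apply, Coalgebra.Repr.tmul_right, Coalgebra.Repr.tmul_left,
    fstHom_tmul, map_smul, map_smul, mul_smul_comm]
  change (_ • S _) * circ (k := k) _ _ = _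
  rw [smul_mul_assoc]

theorem counit_leftAction (a b : A) :
    counit (R := k) (leftAction k a b) = counit (R := k) a * counit (R := k) b := by
  rw [← leftActionHom_tmul, CoalgHomClass.counit_comp_apply]
  simp [mul_comm]

end HopfBrace

/-! ### Normal sub-Hopf braces generate Hopf brace ideals -/

namespace SubHopfBrace

open HopfBrace

variable {k : Type u} {A : Type v} [Field k] [Ring A] [HopfBrace k A]

theorem isSubHopf (B : SubHopfBrace k A) : IsSubHopf (Subalgebra.toSubmodule B.toSubalgebra) where
  one_mem := B.toSubalgebra.one_mem
  mul_mem := fun ha hb => B.toSubalgebra.mul_mem ha hb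
  antipode_mem := fun ha => B.antipode_mem ha
  comul_mem := fun ha => B.comul_mem ha

variable [IsCocomm k A]

variable {B : SubHopfBrace k A}

theorem IsNormal.adj_mem_plus (hB : B.IsNormal) (a : A) {b : A} (hb : b ∈ B.plus) :
    adj k a b ∈ B.plus := by
  refine ⟨hB.adjoint_mem a b hb.1, ?_⟩
  have hb' : counit (R := k) b = 0 := hb.2
  rw [SetLike.mem_coe, LinearMap.mem_ker, counit_adj, hb', mul_zero]

theorem IsNormal.circAdj_mem_plus (hB : B.IsNormal) (a : A) {b : A} (hb : b ∈ B.plus) :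
    adj k (H := CircAlg k A) a b ∈ B.plus := by
  refine ⟨hB.circAdjoint_mem a b hb.1, ?_⟩
  have hb' : counit (R := k) b = 0 := hb.2
  have h := counit_adj (k := k) (H := CircAlg k A) a b
  refine h.trans ?_
  exact (congrArg _ hb').trans (mul_zero _)

theorem IsNormal.leftAction_mem_plus (hB : B.IsNormal) (a : A) {b : A} (hb : b ∈ B.plus) :
    leftAction k a b ∈ B.plus := by
  refine ⟨hB.leftAction_mem a b hb.1, ?_⟩
  have hb' : counit (R := k) b = 0 := hb.2
  rw [SetLike.mem_coe, LinearMap.mem_ker, counit_leftAction, hb', mul_zero]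

theorem IsNormal.mulPlus_eq_circPlus (hB : B.IsNormal) : B.mulPlus = B.circPlus := by
  apply le_antisymm
  · rw [mulPlus, Submodule.map₂_le]
    intro a _ b hb
    rw [LinearMap.mul_apply', mul_eq_sum_circ (k := k)]
    exact Submodule.sum_mem _ fun i _ =>
      Submodule.apply_mem_map₂ (circ (k := k) (H := A)) trivial (hB.leftAction_mem_plus _ hb)
  · rw [circPlus, Submodule.map₂_le]
    intro a _ b hb
    rw [circ_eq_sum]
    exact Submodule.sum_mem _ fun i _ =>
      Submodule.apply_mem_map₂ (LinearMap.mul k A) trivial (hB.leftAction_mem_plus _ hb)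

theorem IsNormal.isIdeal (hB : B.IsNormal) : IsIdeal B.mulPlus where
  mul_mem_left a _ hx := CocommHopf.mul_mem_left hx a
  mul_mem_right a _ hx := CocommHopf.mul_mem_right (fun a _ hb => hB.adj_mem_plus a hb) hx a
  circ_mem_left a x hx := by
    rw [hB.mulPlus_eq_circPlus] at hx ⊢
    exact CocommHopf.mul_mem_left (H := CircAlg k A) (P := B.plus) hx a
  circ_mem_right a x hx := by
    rw [hB.mulPlus_eq_circPlus] at hx ⊢
    exact CocommHopf.mul_mem_right (H := CircAlg k A) (P := B.plus)
      (fun a _ hb => hB.circAdj_mem_plus a hb) hx a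
  isCoideal := B.isSubHopf.isCoideal_mul_plus
  antipode_mem x hx := CocommHopf.antipode_mem (fun a _ hb => hB.adj_mem_plus a hb)
    (fun b hb => ⟨B.antipode_mem hb.1, by
      have hb' : counit (R := k) b = 0 := hb.2
      simp [hb']⟩) hx
  circAntipode_mem x hx := by
    rw [hB.mulPlus_eq_circPlus] at hx ⊢
    refine CocommHopf.antipode_mem (H := CircAlg k A) (P := B.plus)
      (fun a _ hb => hB.circAdj_mem_plus a hb) (fun b hb => ⟨B.circAntipode_mem hb.1, ?_⟩) hx
    have hb' : counit (R := k) b = 0 := hb.2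
    exact (HopfAlgebra.counit_antipode (R := k) (A := CircAlg k A) b).trans hb'

end SubHopfBrace

/-! ### Kernels of Hopf brace morphisms are normal -/

namespace HopfBrace

variable {k : Type u} {A C : Type v} [Field k] [Ring A] [HopfBrace k A] [Ring C] [HopfBrace k C]

/-- A morphism of Hopf braces as a morphism of the second Hopf algebras. -/
noncomputable def Hom.toCircHom (f : Hom k A C) : CircAlg k A →ₐc[k] CircAlg k C where
  toFun := f.toBialgHom
  map_add' := map_add f.toBialgHom
  map_smul' := map_smul f.toBialgHom
  counit_comp := by exact CoalgHomClass.counit_comp f.toBialgHom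
  map_comp_comul := by exact CoalgHomClass.map_comp_comul f.toBialgHom
  map_one' := map_one f.toBialgHom
  map_mul' := f.map_circ

theorem Hom.map_leftAction (f : Hom k A C) (a b : A) :
    f.toBialgHom (leftAction k a b) = leftAction k (f.toBialgHom a) (f.toBialgHom b) := by
  refine Eq.trans ?_
    (leftAction_eq_sum ((ℛ k a).induced (f.toBialgHom : A →ₗc[k] C)) (f.toBialgHom b)).symm
  rw [leftAction_eq_sum (ℛ k a), map_sum]
  refine Finset.sum_congr rfl fun i _ => ?_
  rw [map_mul, map_antipode, f.map_circ]
  rfl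

theorem Hom.map_leftAction_of_trivial (f : Hom k A C) (a : A) {b : A}
    (hb : f.toBialgHom b = algebraMap k C (counit (R := k) b)) :
    f.toBialgHom (leftAction k a b) = (counit (R := k) a * counit (R := k) b) • 1 := by
  rw [f.map_leftAction, hb, leftAction_eq_sum (ℛ k (f.toBialgHom a))]
  simp only [Algebra.algebraMap_eq_smul_one, map_smul, circ_one, mul_smul_comm]
  rw [← Finset.smul_sum, HopfAlgebra.sum_antipode_mul_eq_smul, smul_smul,
    CoalgHomClass.counit_comp_apply, mul_comm]

variable [IsCocomm k A]

/-- The kernel of a morphism of cocommutative Hopf braces, as a sub-Hopf brace. -/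
noncomputable def Hom.ker (f : Hom k A C) : SubHopfBrace k A where
  toSubalgebra := lker f.toBialgHom
  circ_mem := fun ha hb => (lker f.toCircHom).mul_mem ha hb
  comul_mem := fun ha => comul_mem_lker ha
  antipode_mem := fun ha => antipode_mem_lker ha
  circAntipode_mem := fun ha => antipode_mem_lker (f := f.toCircHom) ha

end HopfBrace

namespace SubHopfBrace

open HopfBrace

variable {k : Type u} {A C : Type v} [Field k] [Ring A] [HopfBrace k A] [Ring C] [HopfBrace k C]
  [IsCocomm k A]

/-- If `f` is trivial on `B` and `B` contains the kernel of `f`, then `B` is normal. -/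
theorem isNormal_of_ker_le {B : SubHopfBrace k A} (f : Hom k A C)
    (hf : ∀ b ∈ B.toSubalgebra, f.toBialgHom b = algebraMap k C (counit (R := k) b))
    (hker : ∀ x ∈ f.ker.toSubalgebra, x ∈ B.toSubalgebra) : B.IsNormal where
  adjoint_mem a b hb := hker _ <|
    adj_mem_lker (B := Subalgebra.toSubmodule B.toSubalgebra) (f := f.toBialgHom) hf a
      (B.comul_mem hb)
  circAdjoint_mem a b hb := hker _ <|
    adj_mem_lker (H := CircAlg k A) (B := (Subalgebra.toSubmodule B.toSubalgebra : Submodule k A))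
      (f := f.toCircHom) (fun b hb => by
        refine (hf b hb).trans ?_
        rw [Algebra.algebraMap_eq_smul_one, Algebra.algebraMap_eq_smul_one]
        rfl) a (B.comul_mem hb)
  leftAction_mem a b hb := hker _ <| by
    have := mem_lker_of_trivial (leftActionHom k A) (B := Subalgebra.toSubmodule B.toSubalgebra)
      (f := f.toBialgHom)
      (fun a b hb => by
        rw [leftActionHom_tmul]; exact f.map_leftAction_of_trivial a (hf b hb)) a
      (B.comul_mem hb)
    rwa [leftActionHom_tmul] at this

end SubHopfBrace

namespace HBRcoc

open HopfBrace

variable {k : Type u} {A : Type v} [Field k] [Ring A] [HopfBrace k A] [IsCocomm k A]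

theorem hom_congr {X Y : HBRcoc.{u, v} k} {f g : X ⟶ Y} (h : f = g) (x : X.carrier) :
    HopfBrace.Hom.toBialgHom f x = HopfBrace.Hom.toBialgHom g x := by rw [h]

/-- A sub-Hopf brace that is a kernel is normal. -/
theorem isNormal_of_isLimit {B : SubHopfBrace k A} {C : HBRcoc.{u, v} k} (f : of k A ⟶ C)
    (w : inclusion B ≫ f = 0) (hl : IsLimit (KernelFork.ofι (inclusion B) w)) : B.IsNormal := by
  let f' : HopfBrace.Hom k A C.carrier := f
  refine SubHopfBrace.isNormal_of_ker_le f' (fun b hb => hom_congr w ⟨b, hb⟩) fun x hx => ?_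
  have w' : inclusion f'.ker ≫ f = 0 := by
    apply HopfBrace.Hom.ext
    ext y
    exact apply_of_mem_lker (f := f'.toBialgHom) y.2
  obtain ⟨l, hl'⟩ := KernelFork.IsLimit.lift' hl (inclusion f'.ker) w'
  have h := hom_congr hl' (⟨x, hx⟩ : f'.ker.Carrier)
  have h2 : x = (HopfBrace.Hom.toBialgHom l (⟨x, hx⟩ : f'.ker.Carrier) : B.Carrier).1 := h.symm
  rw [h2]
  exact Subtype.property _

end HBRcoc

/-! ### Quotients by Hopf brace ideals -/

namespace HopfBrace

namespace IsIdeal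

variable {k : Type u} {A : Type v} [Field k] [Ring A] [HopfBrace k A] {I : Submodule k A}

/-- A Hopf brace ideal as a left ideal of the ring `A`. -/
def toIdeal (hI : IsIdeal I) : Ideal A where
  __ := I.toAddSubmonoid
  smul_mem' := hI.mul_mem_left

instance (hI : IsIdeal I) : hI.toIdeal.IsTwoSided := ⟨fun b h => hI.mul_mem_right b _ h⟩

instance (hI : IsIdeal I) : hI.toIdeal.IsHopfIdeal k where
  counit_eq_zero := hI.isCoideal.counit_eq_zero
  map_mkQ_comul_eq_zero := hI.isCoideal.map_mkQ_comul_eq_zero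
  antipode_mem := hI.antipode_mem

/-- The quotient of a Hopf brace by a Hopf brace ideal. -/
abbrev Quotient (hI : IsIdeal I) : Type v := A ⧸ hI.toIdeal

/-- The projection to the quotient by a Hopf brace ideal. -/
noncomputable abbrev mkHom (hI : IsIdeal I) : A →ₐc[k] hI.Quotient :=
  Bialgebra.Quotient.mkBialgHom hI.toIdeal

theorem mkHom_surjective (hI : IsIdeal I) : Function.Surjective hI.mkHom :=
  Ideal.Quotient.mk_surjective

theorem mkHom_eq_zero (hI : IsIdeal I) {x : A} : hI.mkHom x = 0 ↔ x ∈ I :=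
  Ideal.Quotient.eq_zero_iff_mem

/-- The product `•` on the quotient. -/
noncomputable def circQuotient (hI : IsIdeal I) : hI.Quotient →ₗ[k] hI.Quotient →ₗ[k] hI.Quotient :=
  Submodule.liftQ I
    { toFun := fun a => Submodule.mapQ I I (circ (k := k) a) fun x hx => hI.circ_mem_left a x hx
      map_add' := fun a b => Submodule.linearMap_qext _ <| LinearMap.ext fun x =>
        congrArg I.mkQ (LinearMap.map_add₂ (circ (k := k)) a b x)
      map_smul' := fun r a => Submodule.linearMap_qext _ <| LinearMap.ext fun x =>
        congrArg I.mkQ (LinearMap.map_smul₂ (circ (k := k)) r a x) }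
    fun a ha => Submodule.linearMap_qext _ <| LinearMap.ext fun x =>
      hI.mkHom_eq_zero.2 (hI.circ_mem_right x a ha)

theorem circQuotient_mkHom (hI : IsIdeal I) (a b : A) :
    hI.circQuotient (hI.mkHom a) (hI.mkHom b) = hI.mkHom (circ (k := k) a b) := rfl

/-- The antipode `T` on the quotient. -/
noncomputable def circAntipodeQuotient (hI : IsIdeal I) : hI.Quotient →ₗ[k] hI.Quotient :=
  Submodule.mapQ I I (circAntipode (k := k) (H := A)) hI.circAntipode_mem

theorem comul_mkHom (hI : IsIdeal I) (a : A) : comul (R := k) (hI.mkHom a) =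
    TensorProduct.map (hI.mkHom : A →ₗ[k] hI.Quotient) (hI.mkHom : A →ₗ[k] hI.Quotient)
      (comul (R := k) a) := rfl

noncomputable instance (hI : IsIdeal I) : HopfBrace k hI.Quotient where
  circ := hI.circQuotient
  circAntipode := hI.circAntipodeQuotient
  circ_assoc a b c := by
    obtain ⟨a, rfl⟩ := hI.mkHom_surjective a
    obtain ⟨b, rfl⟩ := hI.mkHom_surjective b
    obtain ⟨c, rfl⟩ := hI.mkHom_surjective c
    simp only [circQuotient_mkHom, circ_assoc]
  one_circ a := by
    obtain ⟨a, rfl⟩ := hI.mkHom_surjective a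
    rw [← map_one hI.mkHom, circQuotient_mkHom, one_circ]
  circ_one a := by
    obtain ⟨a, rfl⟩ := hI.mkHom_surjective a
    rw [← map_one hI.mkHom, circQuotient_mkHom, circ_one]
  counit_circ a b := by
    obtain ⟨a, rfl⟩ := hI.mkHom_surjective a
    obtain ⟨b, rfl⟩ := hI.mkHom_surjective b
    rw [circQuotient_mkHom]
    simp only [CoalgHomClass.counit_comp_apply, counit_circ]
  comul_circ a b := by
    obtain ⟨a, rfl⟩ := hI.mkHom_surjective a
    obtain ⟨b, rfl⟩ := hI.mkHom_surjective b
    have h : ∀ s t : A ⊗[k] A,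
        TensorProduct.map (hI.mkHom : A →ₗ[k] hI.Quotient) (hI.mkHom : A →ₗ[k] hI.Quotient)
          (TensorProduct.map₂ (circ (k := k)) (circ (k := k)) s t) =
        TensorProduct.map₂ hI.circQuotient hI.circQuotient
          (TensorProduct.map (hI.mkHom : A →ₗ[k] hI.Quotient) (hI.mkHom : A →ₗ[k] hI.Quotient) s)
          (TensorProduct.map (hI.mkHom : A →ₗ[k] hI.Quotient)
            (hI.mkHom : A →ₗ[k] hI.Quotient) t) := by
      intro s t
      induction s with
      | zero => simp
      | add s s' hs hs' => simp only [map_add, LinearMap.add_apply, hs, hs']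
      | tmul x x' =>
        induction t with
        | zero => simp
        | add t t' ht ht' => simp only [map_add, ht, ht']
        | tmul y y' => rfl
    rw [circQuotient_mkHom, comul_mkHom, comul_circ, h]
    rfl
  circAntipode_circ a := by
    obtain ⟨a, rfl⟩ := hI.mkHom_surjective a
    have h := congrArg hI.mkHom (circAntipode_circ (k := k) a)
    rw [map_smul, map_one] at h
    rw [CoalgHomClass.counit_comp_apply, comul_mkHom, ← h, ← (ℛ k a).eq]
    simp only [map_sum]
    rfl
  circ_circAntipode a := by
    obtain ⟨a, rfl⟩ := hI.mkHom_surjective a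
    have h := congrArg hI.mkHom (circ_circAntipode (k := k) a)
    rw [map_smul, map_one] at h
    rw [CoalgHomClass.counit_comp_apply, comul_mkHom, ← h, ← (ℛ k a).eq]
    simp only [map_sum]
    rfl
  circ_mul a b c := by
    obtain ⟨a, rfl⟩ := hI.mkHom_surjective a
    obtain ⟨b, rfl⟩ := hI.mkHom_surjective b
    obtain ⟨c, rfl⟩ := hI.mkHom_surjective c
    have h : ∀ t : A ⊗[k] A, hI.mkHom (LinearMap.mul' k A
        (TensorProduct.map ((circ (k := k)).flip b)
          (LinearMap.mul' k A ∘ₗ TensorProduct.map (HopfAlgebra.antipode k)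
            ((circ (k := k)).flip c)) ((comul (R := k)).lTensor A t))) =
        LinearMap.mul' k hI.Quotient
          (TensorProduct.map (hI.circQuotient.flip (hI.mkHom b))
            (LinearMap.mul' k hI.Quotient ∘ₗ TensorProduct.map (HopfAlgebra.antipode k)
              (hI.circQuotient.flip (hI.mkHom c))) ((comul (R := k)).lTensor hI.Quotient
                (TensorProduct.map (hI.mkHom : A →ₗ[k] hI.Quotient)
                  (hI.mkHom : A →ₗ[k] hI.Quotient) t))) := by
      intro t
      induction t with
      | zero => simp
      | add s t hs ht => simp only [map_add, hs, ht]
      | tmul x y =>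
        have hy : comul (R := k) ((hI.mkHom : A →ₗ[k] hI.Quotient) y) = ∑ i ∈ (ℛ k y).index,
            hI.mkHom ((ℛ k y).left i) ⊗ₜ[k] hI.mkHom ((ℛ k y).right i) := by
          refine (comul_mkHom hI y).trans ?_
          rw [← (ℛ k y).eq, map_sum]
          rfl
        rw [TensorProduct.map_tmul, LinearMap.lTensor_tmul, LinearMap.lTensor_tmul, hy,
          ← (ℛ k y).eq]
        simp only [TensorProduct.tmul_sum, map_sum]
        rfl
    rw [← map_mul, circQuotient_mkHom, circ_mul, h, comul_mkHom]

instance [IsCocomm k A] (hI : IsIdeal I) : IsCocomm k hI.Quotient where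
  comm_comp_comul := by
    refine LinearMap.ext fun x => ?_
    obtain ⟨a, rfl⟩ := hI.mkHom_surjective x
    have h : ∀ t : A ⊗[k] A, TensorProduct.comm k hI.Quotient hI.Quotient
        (TensorProduct.map (hI.mkHom : A →ₗ[k] hI.Quotient) (hI.mkHom : A →ₗ[k] hI.Quotient) t) =
        TensorProduct.map (hI.mkHom : A →ₗ[k] hI.Quotient) (hI.mkHom : A →ₗ[k] hI.Quotient)
          (TensorProduct.comm k A A t) := by
      intro t
      induction t with
      | zero => simp
      | add s t hs ht => simp only [map_add, hs, ht]
      | tmul x y => rfl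
    rw [LinearMap.comp_apply, LinearEquiv.coe_coe, comul_mkHom, h, Coalgebra.comm_comul]

/-- The projection to the quotient as a morphism of Hopf braces. -/
noncomputable def mkBraceHom (hI : IsIdeal I) : HopfBrace.Hom k A hI.Quotient where
  toBialgHom := hI.mkHom
  map_circ := fun _ _ => rfl

end IsIdeal

end HopfBrace

/-! ### Sub-Hopf braces generating ideals are kernels -/

namespace SubHopfBrace

open HopfBrace

variable {k : Type u} {A D : Type v} [Field k] [Ring A] [HopfBrace k A] [Ring D] [HopfBrace k D]
  {B : SubHopfBrace k A}

/-- Corestriction of a morphism of Hopf braces whose image lies in a sub-Hopf brace. -/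
noncomputable def codRestrict (g : Hom k D A) (hg : ∀ d, g.toBialgHom d ∈ B.toSubalgebra) :
    Hom k D B.Carrier where
  toBialgHom := BialgHom.ofAlgHom ((g.toBialgHom : D →ₐ[k] A).codRestrict B.toSubalgebra hg)
    (AlgHom.toLinearMap_injective (LinearMap.ext fun d =>
      CoalgHomClass.counit_comp_apply g.toBialgHom d))
    (AlgHom.toLinearMap_injective (LinearMap.ext fun d => by
      apply B.map_inclₗ_injective
      refine Eq.trans ?_ ((CoalgHomClass.map_comp_comul_apply g.toBialgHom d).trans
        (B.map_comul ⟨g.toBialgHom d, hg d⟩).symm)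
      change TensorProduct.map B.inclₗ B.inclₗ (TensorProduct.map _ _ (comul (R := k) d)) = _
      rw [← LinearMap.comp_apply, ← TensorProduct.map_comp]
      rfl))
  map_circ := fun a b => Subtype.ext (g.map_circ a b)

theorem mkQ_mulPlus_of_mem {b : A} (hb : b ∈ B.toSubalgebra) :
    B.mulPlus.mkQ b = B.mulPlus.mkQ (algebraMap k A (counit (R := k) b)) := by
  rw [← sub_eq_zero, ← map_sub, Submodule.mkQ_apply, Submodule.Quotient.mk_eq_zero]
  have h : b - algebraMap k A (counit (R := k) b) ∈ B.plus := by
    refine ⟨B.toSubalgebra.sub_mem hb (B.toSubalgebra.algebraMap_mem _), ?_⟩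
    rw [SetLike.mem_coe, LinearMap.mem_ker]
    simp
  have := Submodule.apply_mem_map₂ (LinearMap.mul k A) (Submodule.mem_top (x := (1 : A))) h
  rwa [LinearMap.mul_apply', one_mul] at this

variable [IsCocomm k A]

/-- A morphism into `A` which is trivial modulo `A · B⁺` takes its values in `B`. -/
theorem mem_of_mkQ_eq (g : D →ₐc[k] A)
    (hg : ∀ d, B.mulPlus.mkQ (g d) = B.mulPlus.mkQ (algebraMap k A (counit (R := k) d))) (d : D) :
    g d ∈ B.toSubalgebra := by
  refine B.isSubHopf.mem_of_coinvariant ?_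
  change B.mulPlus.mkQ.rTensor A _ = B.mulPlus.mkQ 1 ⊗ₜ g d
  have hd : comul (R := k) (g d) =
      ∑ i ∈ (ℛ k d).index, g ((ℛ k d).left i) ⊗ₜ[k] g ((ℛ k d).right i) :=
    ((ℛ k d).induced (g : D →ₗc[k] A)).eq.symm
  rw [hd, map_sum]
  conv_rhs => rw [← Coalgebra.sum_counit_smul (ℛ k d), map_sum, TensorProduct.tmul_sum]
  refine Finset.sum_congr rfl fun i _ => ?_
  rw [LinearMap.rTensor_tmul, hg, Algebra.algebraMap_eq_smul_one, map_smul, map_smul,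
    TensorProduct.smul_tmul]

end SubHopfBrace

namespace HBRcoc

open HopfBrace

variable {k : Type u} {A : Type v} [Field k] [Ring A] [HopfBrace k A] [IsCocomm k A]
  {B : SubHopfBrace k A}

instance : Mono (inclusion B) where
  right_cancellation g h w := by
    apply HopfBrace.Hom.ext
    exact DFunLike.ext _ _ fun d => Subtype.ext (hom_congr w d)

theorem inclusion_comp_mkBraceHom (hI : IsIdeal B.mulPlus) :
    inclusion B ≫ (show of k A ⟶ of k hI.Quotient from hI.mkBraceHom) = 0 := by
  apply HopfBrace.Hom.ext
  refine DFunLike.ext _ _ fun b => ?_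
  exact SubHopfBrace.mkQ_mulPlus_of_mem b.2

/-- If `A · B⁺` is a Hopf brace ideal, then `B` is the kernel of the projection to the quotient. -/
noncomputable def isLimitOfIsIdeal (hI : IsIdeal B.mulPlus) :
    IsLimit (KernelFork.ofι (inclusion B) (inclusion_comp_mkBraceHom hI)) :=
  KernelFork.IsLimit.ofι' _ _ fun g hg =>
    ⟨SubHopfBrace.codRestrict g (SubHopfBrace.mem_of_mkQ_eq (HopfBrace.Hom.toBialgHom g)
      fun d => hom_congr hg d), rfl⟩

end HBRcoc

/-! ### The equivalence -/

theorem proposition3p4 {k : Type u} [Field k] {A : Type v} [Ring A] [HopfBrace k A]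
    [Coalgebra.IsCocomm k A] (B : SubHopfBrace k A) :
    List.TFAE
      [B.IsNormal,
        B.mulPlus = B.circPlus ∧ HopfBrace.IsIdeal B.mulPlus,
        ∃ (C : HBRcoc.{u, v} k) (f : HBRcoc.of k A ⟶ C) (w : HBRcoc.inclusion B ≫ f = 0),
          Nonempty (IsLimit (KernelFork.ofι (HBRcoc.inclusion B) w))] := by
  tfae_have 1 → 2 := fun hB => ⟨hB.mulPlus_eq_circPlus, hB.isIdeal⟩
  tfae_have 2 → 3 := fun h => ⟨HBRcoc.of k h.2.Quotient, h.2.mkBraceHom,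
    HBRcoc.inclusion_comp_mkBraceHom h.2, ⟨HBRcoc.isLimitOfIsIdeal h.2⟩⟩
  tfae_have 3 → 1 := fun ⟨_, f, w, ⟨hl⟩⟩ => HBRcoc.isNormal_of_isLimit f w hl
  tfae_finish
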